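/- Let $k$ be a field and $n\ge 2$. For $\mathbf d\in\mathbb Z^n$ put $\deg(\mathbf d)=d_1+\dots+d_n$. A function on $\mathbb Z^n$ is initially (eventually) zero if it vanishes whenever the degree is sufficiently small (large). A Riemann function with offset $C\in\mathbb Z$ is an initially zero $f:\mathbb Z^n\to\mathbb Z$ with $f(\mathbf d)=\deg(\mathbf d)+C$ for $\deg(\mathbf d)$ sufficiently large; for $\mathbf K\in\mathbb Z^n$ put $f^\wedge_{\mathbf K}(\mathbf d)=f(\mathbf K-\mathbf d)-\deg(\mathbf K-\mathbf d)-C$. The weight of an initially zero $g:\mathbb Z^2\to\mathbb Z$ is the unique initially zero $W$ with $g(\mathbf d)=\sum_{\mathbf a\le\mathbf d}W(\mathbf a)$ for all $\mathbf d$. For distinct $i,j$, let $W_{f;i,j,\mathbf d}$ be the weight of $(a_1,a_2)\mapsto f(\mathbf d+a_1\mathbf e_i+a_2\mathbf e_j)$. A perfect matching is an initially and eventually zero $W:\mathbb Z^2\to\mathbb Z$ which is the indicator function of the graph of a bijection $\mathbb Z\to\mathbb Z$. A $k$-diagram $\mathcal F$ consists of $k$-vector spaces and linear maps $B_1\xrightarrow{\rho_{11}}A_1\xleftarrow{\rho_{31}}B_3\xrightarrow{\rho_{32}}A_2\xleftarrow{\rho_{22}}B_2$;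 $H^0(\mathcal F)$ and $H^1(\mathcal F)$ are the kernel and cokernel of $B_1\oplus B_2\oplus B_3\to A_1\oplus A_2$, $(b_1,b_2,b_3)\mapsto(\rho_{11}b_1-\rho_{31}b_3,\ \rho_{22}b_2-\rho_{32}b_3)$. It is Fredholm if both are finite dimensional. A virtual $k$-diagram is a pair $\mathcal F_1\ominus\mathcal F_2$ of Fredholm $k$-diagrams, and $\mathcal F_1\ominus\mathcal F_2\sim\mathcal F_1'\ominus\mathcal F_2'$ if $\mathcal F_1\oplus\mathcal F_2'\oplus\mathcal G\simeq\mathcal F_1'\oplus\mathcal F_2\oplus\mathcal G$ for some Fredholm $\mathcal G$. On the class of $\mathcal F_1\ominus\mathcal F_2$, $b^i=\dim H^i(\mathcal F_1)-\dim H^i(\mathcal F_2)$ and $\chi=b^0-b^1$. For $\mathbf d\in\mathbb Z^2$ and a perfect matching $W$ with support $S$, $\mathcal M_{W,\mathbf d}$ is the $k$-diagram with $B_i=k^{\oplus\mathbb Z_{\le d_i}}$, $A_i=k^{\oplus\mathbb Z}$ ($i=1,2$), $B_3=k^{\oplus S}$, where $\rho_{11},\rho_{22}$ are the inclusions and $\rho_{31},\rho_{32}$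 are induced by the two projections $S\to\mathbb Z$. For $W:\mathbb Z^2\to\mathbb Z_{\ge0}$, $\mathcal I^{\oplus W}_{\mathbf d}$ is the direct sum over $\mathbf a\in\mathbb Z^2$ of $W(\mathbf a)$ copies of the $k$-diagram with $A_1=A_2=B_3=k$, with $B_j=k$ if $a_j\le d_j$ and $B_j=0$ otherwise ($j=1,2$), and with identities and inclusions as maps. Theorem. Let $f:\mathbb Z^n\to\mathbb Z$ be any Riemann function with offset $C$, and let $\mathbf d,\mathbf K\in\mathbb Z^n$. (1) For all distinct $i,j\in\{1,\dots,n\}$ the weight $W=W_{f;i,j,\mathbf d}$ exists and is unique. It can be written as $W=(W_1+\dots+W_s)-(\tilde W_1+\dots+\tilde W_{s-1})$ with some $s\ge1$ and perfect matchings $W_r,\tilde W_r$ if and only if it is bounded. (2) There is a unique class $[\mathcal M_{f\text{ at }\mathbf d}]$ of virtual $k$-diagrams such that for all distinct $i,j$, with $W=W_{f;i,j,\mathbf d}$, it is the class of $\bigoplus_{r}\mathcal M_{W_r,\mathbf 0}\ominus\bigoplus_{r}\mathcal M_{\tilde W_r,\mathbf 0}$ for every expression of $W$ as in (1), and also the class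 of $\mathcal I^{\oplus W^+}_{\mathbf 0}\ominus\mathcal I^{\oplus W^-}_{\mathbf 0}$, where $W^{\pm}=\max(\pm W,0)$; in particular, all these $k$-diagrams are Fredholm, and the class does not depend on $i,j$ or on the expression. (3) $f^\wedge_{\mathbf K}$ is a Riemann function with offset $-\deg(\mathbf K)-C$, so that (1) and (2) apply to it too, and $$b^0([\mathcal M_{f\text{ at }\mathbf d}])=f(\mathbf d),\qquad \chi([\mathcal M_{f\text{ at }\mathbf d}])=\deg(\mathbf d)+C,$$ $$b^1([\mathcal M_{f\text{ at }\mathbf d}])=f^\wedge_{\mathbf K}(\mathbf K-\mathbf d)=b^0([\mathcal M_{f^\wedge_{\mathbf K}\text{ at }\mathbf K-\mathbf d}]).$$ -/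

import Mathlib

universe u

/-! ### Riemann functions and their weights -/

/-- The degree `d₁ + ⋯ + dₙ` of a vector in `ℤⁿ`. -/
def vecDeg {n : ℕ} (d : Fin n → ℤ) : ℤ := ∑ i, d i

/-- `f(d) = 0` for `deg(d)` sufficiently small. -/
def IsInitiallyZero {n : ℕ} (f : (Fin n → ℤ) → ℤ) : Prop :=
  ∃ a : ℤ, ∀ d, vecDeg d ≤ a → f d = 0

/-- `f(d) = 0` for `deg(d)` sufficiently large. -/
def IsEventuallyZero {n : ℕ} (f : (Fin n → ℤ) → ℤ) : Prop :=
  ∃ b : ℤ, ∀ d, b ≤ vecDeg d → f d = 0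

/-- `f` is a Riemann function with offset `C`. -/
def IsRiemannFunction {n : ℕ} (f : (Fin n → ℤ) → ℤ) (C : ℤ) : Prop :=
  IsInitiallyZero f ∧ ∃ b : ℤ, ∀ d, b ≤ vecDeg d → f d = vecDeg d + C

/-- The `K`-dual `f^∧_K` of a Riemann function `f` with offset `C`. -/
def riemannDual {n : ℕ} (f : (Fin n → ℤ) → ℤ) (C : ℤ) (K : Fin n → ℤ) : (Fin n → ℤ) → ℤ :=
  fun d => f (K - d) - vecDeg (K - d) - C

/-- `W` is the weight of `f`: it is initially zero and `f(d) = ∑_{a ≤ d} W(a)` for all `d`.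
(As `W` is initially zero, only finitely many terms of each sum are nonzero.) -/
def IsWeight {n : ℕ} (f W : (Fin n → ℤ) → ℤ) : Prop :=
  IsInitiallyZero W ∧ ∀ d, f d = ∑ᶠ (a : Fin n → ℤ) (_ : a ≤ d), W a

/-- The two-variable restriction `f_{i,j,d}(a₁, a₂) = f(d + a₁ eᵢ + a₂ eⱼ)`. -/
def twoVarRestriction {n : ℕ} (f : (Fin n → ℤ) → ℤ) (i j : Fin n) (d : Fin n → ℤ) :
    (Fin 2 → ℤ) → ℤ :=
  fun a => f (d + Pi.single i (a 0) + Pi.single j (a 1))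

/-- `W : ℤ² → ℤ` is a perfect matching: it is initially and eventually zero, and it is the
indicator function of the graph of a bijection `ℤ → ℤ`. -/
def IsPerfectMatching (W : (Fin 2 → ℤ) → ℤ) : Prop :=
  IsInitiallyZero W ∧ IsEventuallyZero W ∧
    ∃ π : Equiv.Perm ℤ, ∀ a, W a = if a 1 = π (a 0) then 1 else 0

/-- `W = (P₁ + ⋯ + P_{s+1}) - (Q₁ + ⋯ + Q_s)` with perfect matchings `Pᵢ` and `Qᵢ`. -/
def IsMatchingDecomposition (W : (Fin 2 → ℤ) → ℤ) {s : ℕ}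
    (P : Fin (s + 1) → (Fin 2 → ℤ) → ℤ) (Q : Fin s → (Fin 2 → ℤ) → ℤ) : Prop :=
  (∀ i, IsPerfectMatching (P i)) ∧ (∀ i, IsPerfectMatching (Q i)) ∧
    ∀ a, W a = ∑ i, P i a - ∑ i, Q i a

/-! ### `k`-diagrams -/

/-- A `k`-diagram: five `k`-vector spaces and four linear maps
`B₁ → A₁ ← B₃ → A₂ ← B₂`. -/
structure KDiagram (k : Type u) [Field k] : Type (u + 1) where
  (B₁ B₂ B₃ A₁ A₂ : Type u)
  [grpB₁ : AddCommGroup B₁] [grpB₂ : AddCommGroup B₂] [grpB₃ : AddCommGroup B₃]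
  [grpA₁ : AddCommGroup A₁] [grpA₂ : AddCommGroup A₂]
  [modB₁ : Module k B₁] [modB₂ : Module k B₂] [modB₃ : Module k B₃]
  [modA₁ : Module k A₁] [modA₂ : Module k A₂]
  ρ₁₁ : B₁ →ₗ[k] A₁
  ρ₂₂ : B₂ →ₗ[k] A₂
  ρ₃₁ : B₃ →ₗ[k] A₁
  ρ₃₂ : B₃ →ₗ[k] A₂

attribute [instance] KDiagram.grpB₁ KDiagram.grpB₂ KDiagram.grpB₃ KDiagram.grpA₁ KDiagram.grpA₂
  KDiagram.modB₁ KDiagram.modB₂ KDiagram.modB₃ KDiagram.modA₁ KDiagram.modA₂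

namespace KDiagram

variable {k : Type u} [Field k]

/-- The differential `(b₁, b₂, b₃) ↦ (ρ₁₁ b₁ - ρ₃₁ b₃, ρ₂₂ b₂ - ρ₃₂ b₃)`. -/
def differential (F : KDiagram k) : (F.B₁ × F.B₂ × F.B₃) →ₗ[k] (F.A₁ × F.A₂) where
  toFun b := (F.ρ₁₁ b.1 - F.ρ₃₁ b.2.2, F.ρ₂₂ b.2.1 - F.ρ₃₂ b.2.2)
  map_add' x y := by
    simp only [Prod.fst_add, Prod.snd_add, map_add, Prod.mk_add_mk]
    congr 1 <;> abel
  map_smul' c x := by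
    simp [smul_sub]

/-- `H⁰`, the kernel of the differential. -/
abbrev H0 (F : KDiagram k) : Type u := LinearMap.ker F.differential

/-- `H¹`, the cokernel of the differential. -/
abbrev H1 (F : KDiagram k) : Type u := (F.A₁ × F.A₂) ⧸ LinearMap.range F.differential

/-- Both cohomology groups are finite dimensional. -/
def IsFredholm (F : KDiagram k) : Prop :=
  Module.Finite k F.H0 ∧ Module.Finite k F.H1

/-- An isomorphism of `k`-diagrams. -/
structure Iso (F G : KDiagram k) where
  b₁ : F.B₁ ≃ₗ[k] G.B₁
  b₂ : F.B₂ ≃ₗ[k] G.B₂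
  b₃ : F.B₃ ≃ₗ[k] G.B₃
  a₁ : F.A₁ ≃ₗ[k] G.A₁
  a₂ : F.A₂ ≃ₗ[k] G.A₂
  comm₁₁ : ∀ x, G.ρ₁₁ (b₁ x) = a₁ (F.ρ₁₁ x)
  comm₂₂ : ∀ x, G.ρ₂₂ (b₂ x) = a₂ (F.ρ₂₂ x)
  comm₃₁ : ∀ x, G.ρ₃₁ (b₃ x) = a₁ (F.ρ₃₁ x)
  comm₃₂ : ∀ x, G.ρ₃₂ (b₃ x) = a₂ (F.ρ₃₂ x)

/-- The direct sum of two `k`-diagrams. -/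
def sum (F G : KDiagram k) : KDiagram k where
  B₁ := F.B₁ × G.B₁
  B₂ := F.B₂ × G.B₂
  B₃ := F.B₃ × G.B₃
  A₁ := F.A₁ × G.A₁
  A₂ := F.A₂ × G.A₂
  ρ₁₁ := F.ρ₁₁.prodMap G.ρ₁₁
  ρ₂₂ := F.ρ₂₂.prodMap G.ρ₂₂
  ρ₃₁ := F.ρ₃₁.prodMap G.ρ₃₁
  ρ₃₂ := F.ρ₃₂.prodMap G.ρ₃₂

/-- The zero `k`-diagram. -/
def zero (k : Type u) [Field k] : KDiagram k where
  B₁ := PUnit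
  B₂ := PUnit
  B₃ := PUnit
  A₁ := PUnit
  A₂ := PUnit
  ρ₁₁ := 0
  ρ₂₂ := 0
  ρ₃₁ := 0
  ρ₃₂ := 0

open scoped DirectSum in
/-- The direct sum of a family of `k`-diagrams. -/
noncomputable def directSum {ι : Type} (F : ι → KDiagram k) : KDiagram k where
  B₁ := ⨁ i, (F i).B₁
  B₂ := ⨁ i, (F i).B₂
  B₃ := ⨁ i, (F i).B₃
  A₁ := ⨁ i, (F i).A₁
  A₂ := ⨁ i, (F i).A₂
  ρ₁₁ := DirectSum.lmap fun i => (F i).ρ₁₁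
  ρ₂₂ := DirectSum.lmap fun i => (F i).ρ₂₂
  ρ₃₁ := DirectSum.lmap fun i => (F i).ρ₃₁
  ρ₃₂ := DirectSum.lmap fun i => (F i).ρ₃₂

namespace Iso

def refl (F : KDiagram k) : Iso F F where
  b₁ := .refl k _
  b₂ := .refl k _
  b₃ := .refl k _
  a₁ := .refl k _
  a₂ := .refl k _
  comm₁₁ _ := rfl
  comm₂₂ _ := rfl
  comm₃₁ _ := rfl
  comm₃₂ _ := rfl

def symm {F G : KDiagram k} (e : Iso F G) : Iso G F where
  b₁ := e.b₁.symm
  b₂ := e.b₂.symm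
  b₃ := e.b₃.symm
  a₁ := e.a₁.symm
  a₂ := e.a₂.symm
  comm₁₁ x := by rw [LinearEquiv.eq_symm_apply, ← e.comm₁₁, LinearEquiv.apply_symm_apply]
  comm₂₂ x := by rw [LinearEquiv.eq_symm_apply, ← e.comm₂₂, LinearEquiv.apply_symm_apply]
  comm₃₁ x := by rw [LinearEquiv.eq_symm_apply, ← e.comm₃₁, LinearEquiv.apply_symm_apply]
  comm₃₂ x := by rw [LinearEquiv.eq_symm_apply, ← e.comm₃₂, LinearEquiv.apply_symm_apply]

def trans {F G H : KDiagram k} (e : Iso F G) (e' : Iso G H) : Iso F H where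
  b₁ := e.b₁.trans e'.b₁
  b₂ := e.b₂.trans e'.b₂
  b₃ := e.b₃.trans e'.b₃
  a₁ := e.a₁.trans e'.a₁
  a₂ := e.a₂.trans e'.a₂
  comm₁₁ x := by simp [e.comm₁₁, e'.comm₁₁]
  comm₂₂ x := by simp [e.comm₂₂, e'.comm₂₂]
  comm₃₁ x := by simp [e.comm₃₁, e'.comm₃₁]
  comm₃₂ x := by simp [e.comm₃₂, e'.comm₃₂]

def sumCongr {F F' G G' : KDiagram k} (e : Iso F F') (e' : Iso G G') :
    Iso (F.sum G) (F'.sum G') where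
  b₁ := e.b₁.prodCongr e'.b₁
  b₂ := e.b₂.prodCongr e'.b₂
  b₃ := e.b₃.prodCongr e'.b₃
  a₁ := e.a₁.prodCongr e'.a₁
  a₂ := e.a₂.prodCongr e'.a₂
  comm₁₁ x := Prod.ext (e.comm₁₁ x.1) (e'.comm₁₁ x.2)
  comm₂₂ x := Prod.ext (e.comm₂₂ x.1) (e'.comm₂₂ x.2)
  comm₃₁ x := Prod.ext (e.comm₃₁ x.1) (e'.comm₃₁ x.2)
  comm₃₂ x := Prod.ext (e.comm₃₂ x.1) (e'.comm₃₂ x.2)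

def sumComm (F G : KDiagram k) : Iso (F.sum G) (G.sum F) where
  b₁ := LinearEquiv.prodComm k _ _
  b₂ := LinearEquiv.prodComm k _ _
  b₃ := LinearEquiv.prodComm k _ _
  a₁ := LinearEquiv.prodComm k _ _
  a₂ := LinearEquiv.prodComm k _ _
  comm₁₁ _ := rfl
  comm₂₂ _ := rfl
  comm₃₁ _ := rfl
  comm₃₂ _ := rfl

def sumAssoc (F G H : KDiagram k) : Iso ((F.sum G).sum H) (F.sum (G.sum H)) where
  b₁ := LinearEquiv.prodAssoc k _ _ _
  b₂ := LinearEquiv.prodAssoc k _ _ _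
  b₃ := LinearEquiv.prodAssoc k _ _ _
  a₁ := LinearEquiv.prodAssoc k _ _ _
  a₂ := LinearEquiv.prodAssoc k _ _ _
  comm₁₁ _ := rfl
  comm₂₂ _ := rfl
  comm₃₁ _ := rfl
  comm₃₂ _ := rfl

def unitProd (V : Type u) [AddCommGroup V] [Module k V] : (PUnit.{u + 1} × V) ≃ₗ[k] V where
  toFun x := x.2
  invFun x := (PUnit.unit, x)
  map_add' _ _ := rfl
  map_smul' _ _ := rfl
  left_inv _ := rfl
  right_inv _ := rfl

def zeroSum (F : KDiagram k) : Iso ((zero k).sum F) F where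
  b₁ := unitProd F.B₁
  b₂ := unitProd F.B₂
  b₃ := unitProd F.B₃
  a₁ := unitProd F.A₁
  a₂ := unitProd F.A₂
  comm₁₁ _ := rfl
  comm₂₂ _ := rfl
  comm₃₁ _ := rfl
  comm₃₂ _ := rfl

/-- An isomorphism of diagrams induces one of the domains of the differentials. -/
def eqvB {F G : KDiagram k} (e : Iso F G) :
    (F.B₁ × F.B₂ × F.B₃) ≃ₗ[k] (G.B₁ × G.B₂ × G.B₃) :=
  e.b₁.prodCongr (e.b₂.prodCongr e.b₃)

/-- An isomorphism of diagrams induces one of the codomains of the differentials. -/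
def eqvA {F G : KDiagram k} (e : Iso F G) : (F.A₁ × F.A₂) ≃ₗ[k] (G.A₁ × G.A₂) :=
  e.a₁.prodCongr e.a₂

theorem differential_eqvB {F G : KDiagram k} (e : Iso F G) (x : F.B₁ × F.B₂ × F.B₃) :
    G.differential (e.eqvB x) = e.eqvA (F.differential x) := by
  simp [differential, eqvB, eqvA, e.comm₁₁, e.comm₂₂, e.comm₃₁, e.comm₃₂]

def eqvH0 {F G : KDiagram k} (e : Iso F G) : F.H0 ≃ₗ[k] G.H0 :=
  e.eqvB.ofSubmodules _ _ (by
    ext y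
    simp only [Submodule.mem_map, LinearMap.mem_ker]
    constructor
    · rintro ⟨x, hx, rfl⟩
      have := e.differential_eqvB x
      rw [hx, map_zero] at this
      exact this
    · intro hy
      refine ⟨e.eqvB.symm y, ?_, e.eqvB.apply_symm_apply y⟩
      have := e.differential_eqvB (e.eqvB.symm y)
      rw [e.eqvB.apply_symm_apply, hy] at this
      exact (LinearEquiv.map_eq_zero_iff _).1 this.symm)

noncomputable def eqvH1 {F G : KDiagram k} (e : Iso F G) : F.H1 ≃ₗ[k] G.H1 :=
  Submodule.Quotient.equiv _ _ e.eqvA (by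
    ext y
    simp only [Submodule.mem_map, LinearMap.mem_range]
    constructor
    · rintro ⟨_, ⟨x, rfl⟩, rfl⟩
      exact ⟨e.eqvB x, e.differential_eqvB x⟩
    · rintro ⟨x, rfl⟩
      refine ⟨_, ⟨e.eqvB.symm x, rfl⟩, ?_⟩
      have := e.differential_eqvB (e.eqvB.symm x)
      rw [e.eqvB.apply_symm_apply] at this
      exact this.symm)

end Iso

def sumH0 (F G : KDiagram k) : (F.sum G).H0 ≃ₗ[k] (F.H0 × G.H0) where
  toFun x :=
    (⟨(x.1.1.1, x.1.2.1.1, x.1.2.2.1), by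
        have h := x.2
        rw [LinearMap.mem_ker] at h
        exact Prod.ext (congrArg (fun y => y.1.1) h) (congrArg (fun y => y.2.1) h)⟩,
     ⟨(x.1.1.2, x.1.2.1.2, x.1.2.2.2), by
        have h := x.2
        rw [LinearMap.mem_ker] at h
        exact Prod.ext (congrArg (fun y => y.1.2) h) (congrArg (fun y => y.2.2) h)⟩)
  invFun y :=
    ⟨((y.1.1.1, y.2.1.1), (y.1.1.2.1, y.2.1.2.1), (y.1.1.2.2, y.2.1.2.2)), by
      have h : F.differential y.1.1 = 0 := y.1.2
      have h' : G.differential y.2.1 = 0 := y.2.2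
      change _ = ((0, 0), (0, 0))
      have h₁ := congrArg Prod.fst h
      have h₂ := congrArg Prod.snd h
      have h₁' := congrArg Prod.fst h'
      have h₂' := congrArg Prod.snd h'
      exact Prod.ext (Prod.ext h₁ h₁') (Prod.ext h₂ h₂')⟩
  map_add' _ _ := rfl
  map_smul' _ _ := rfl
  left_inv _ := rfl
  right_inv _ := rfl

noncomputable def sumH1 (F G : KDiagram k) : (F.sum G).H1 ≃ₗ[k] (F.H1 × G.H1) :=
  let φ : ((F.sum G).A₁ × (F.sum G).A₂) →ₗ[k] (F.H1 × G.H1) :=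
    ((LinearMap.range F.differential).mkQ.prodMap (LinearMap.range G.differential).mkQ).comp
      (LinearEquiv.prodProdProdComm k F.A₁ G.A₁ F.A₂ G.A₂).toLinearMap
  (Submodule.quotEquivOfEq (LinearMap.range (F.sum G).differential) (LinearMap.ker φ) (by
    ext y
    have hy : y ∈ LinearMap.ker φ ↔ (y.1.1, y.2.1) ∈ LinearMap.range F.differential ∧
        (y.1.2, y.2.2) ∈ LinearMap.range G.differential := by
      refine (Prod.ext_iff (x := φ y) (y := 0)).trans (and_congr ?_ ?_)
      · exact Submodule.Quotient.mk_eq_zero (LinearMap.range F.differential)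
      · exact Submodule.Quotient.mk_eq_zero (LinearMap.range G.differential)
    refine Iff.trans ?_ hy.symm
    constructor
    · rintro ⟨x, rfl⟩
      exact ⟨⟨(x.1.1, x.2.1.1, x.2.2.1), rfl⟩, ⟨(x.1.2, x.2.1.2, x.2.2.2), rfl⟩⟩
    · rintro ⟨⟨x, hx⟩, ⟨x', hx'⟩⟩
      refine ⟨((x.1, x'.1), (x.2.1, x'.2.1), (x.2.2, x'.2.2)), ?_⟩
      have h₁ := congrArg Prod.fst hx
      have h₂ := congrArg Prod.snd hx
      have h₁' := congrArg Prod.fst hx'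
      have h₂' := congrArg Prod.snd hx'
      exact Prod.ext (Prod.ext h₁ h₁') (Prod.ext h₂ h₂'))).trans
  (φ.quotKerEquivOfSurjective (by
    rintro ⟨x, y⟩
    obtain ⟨x, rfl⟩ := Submodule.Quotient.mk_surjective _ x
    obtain ⟨y, rfl⟩ := Submodule.Quotient.mk_surjective _ y
    exact ⟨((x.1, y.1), (x.2, y.2)), rfl⟩))

theorem IsFredholm.sum {F G : KDiagram k} (hF : F.IsFredholm) (hG : G.IsFredholm) :
    (F.sum G).IsFredholm := by
  obtain ⟨h0, h1⟩ := hF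
  obtain ⟨g0, g1⟩ := hG
  exact ⟨Module.Finite.equiv (sumH0 F G).symm, Module.Finite.equiv (sumH1 F G).symm⟩

theorem isFredholm_zero : (zero k).IsFredholm := by
  refine ⟨?_, ?_⟩
  · have : Subsingleton ((zero k).B₁ × (zero k).B₂ × (zero k).B₃) :=
      inferInstanceAs (Subsingleton (PUnit × PUnit × PUnit))
    infer_instance
  · have : Subsingleton ((zero k).A₁ × (zero k).A₂) :=
      inferInstanceAs (Subsingleton (PUnit × PUnit))
    have : Module.Finite k ((zero k).A₁ × (zero k).A₂) := inferInstance
    infer_instance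

end KDiagram

/-! ### Virtual `k`-diagrams -/

/-- Fredholm `k`-diagrams. -/
def FredholmDiagram (k : Type u) [Field k] : Type (u + 1) :=
  {F : KDiagram k // F.IsFredholm}

instance FredholmDiagram.setoid (k : Type u) [Field k] : Setoid (FredholmDiagram k) where
  r F G := Nonempty (KDiagram.Iso F.1 G.1)
  iseqv :=
    { refl := fun F => ⟨.refl F.1⟩
      symm := fun ⟨e⟩ => ⟨e.symm⟩
      trans := fun ⟨e⟩ ⟨e'⟩ => ⟨e.trans e'⟩ }

/-- Isomorphism classes of Fredholm `k`-diagrams. -/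
def FredholmClass (k : Type u) [Field k] : Type (u + 1) :=
  Quotient (FredholmDiagram.setoid k)

namespace FredholmClass

variable {k : Type u} [Field k]

/-- The isomorphism class of a Fredholm `k`-diagram. -/
def of (F : KDiagram k) (hF : F.IsFredholm) : FredholmClass k :=
  Quotient.mk (FredholmDiagram.setoid k) ⟨F, hF⟩

theorem of_eq_of_iff {F G : KDiagram k} {hF : F.IsFredholm} {hG : G.IsFredholm} :
    of F hF = of G hG ↔ Nonempty (F.Iso G) :=
  ⟨fun h => Quotient.exact h, fun h => Quotient.sound h⟩

instance : Add (FredholmClass k) where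
  add := Quotient.map₂ (fun F G => ⟨F.1.sum G.1, F.2.sum G.2⟩)
    (fun _ _ ⟨e⟩ _ _ ⟨e'⟩ => ⟨e.sumCongr e'⟩)

instance : Zero (FredholmClass k) where
  zero := of (KDiagram.zero k) KDiagram.isFredholm_zero

/-- The commutative monoid of isomorphism classes of Fredholm `k`-diagrams under direct sum. -/
instance : AddCommMonoid (FredholmClass k) where
  add_assoc := by
    rintro ⟨F⟩ ⟨G⟩ ⟨H⟩
    exact Quotient.sound ⟨.sumAssoc F.1 G.1 H.1⟩
  add_comm := by
    rintro ⟨F⟩ ⟨G⟩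
    exact Quotient.sound ⟨.sumComm F.1 G.1⟩
  zero_add := by
    rintro ⟨F⟩
    exact Quotient.sound ⟨.zeroSum F.1⟩
  add_zero := by
    rintro ⟨F⟩
    exact Quotient.sound ⟨(KDiagram.Iso.sumComm F.1 (KDiagram.zero k)).trans (.zeroSum F.1)⟩
  nsmul := nsmulRec

theorem of_add_of (F G : KDiagram k) (hF : F.IsFredholm) (hG : G.IsFredholm) :
    of F hF + of G hG = of (F.sum G) (hF.sum hG) := rfl

/-- The map `F ↦ dim H⁰(F)` on isomorphism classes, as an additive map to `ℤ`. -/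
noncomputable def betti0 : FredholmClass k →+ ℤ where
  toFun := Quotient.lift (fun F => (Module.finrank k F.1.H0 : ℤ))
    (fun _ _ ⟨e⟩ => congrArg Nat.cast e.eqvH0.finrank_eq)
  map_zero' := by
    have : Subsingleton ((KDiagram.zero k).B₁ × (KDiagram.zero k).B₂ × (KDiagram.zero k).B₃) :=
      inferInstanceAs (Subsingleton (PUnit × PUnit × PUnit))
    exact congrArg Nat.cast (Module.finrank_zero_of_subsingleton (R := k))
  map_add' := by
    rintro ⟨F⟩ ⟨G⟩
    have := F.2.1
    have := G.2.1
    have h : Module.finrank k (F.1.sum G.1).H0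
        = Module.finrank k F.1.H0 + Module.finrank k G.1.H0 := by
      rw [(KDiagram.sumH0 F.1 G.1).finrank_eq, Module.finrank_prod]
    exact (congrArg (Nat.cast (R := ℤ)) h).trans (Nat.cast_add _ _)

/-- The map `F ↦ dim H¹(F)` on isomorphism classes, as an additive map to `ℤ`. -/
noncomputable def betti1 : FredholmClass k →+ ℤ where
  toFun := Quotient.lift (fun F => (Module.finrank k F.1.H1 : ℤ))
    (fun _ _ ⟨e⟩ => congrArg Nat.cast e.eqvH1.finrank_eq)
  map_zero' := by
    have : Subsingleton ((KDiagram.zero k).A₁ × (KDiagram.zero k).A₂) :=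
      inferInstanceAs (Subsingleton (PUnit × PUnit))
    have : Subsingleton (KDiagram.zero k).H1 :=
      (Submodule.Quotient.mk_surjective _).subsingleton
    exact congrArg Nat.cast (Module.finrank_zero_of_subsingleton (R := k))
  map_add' := by
    rintro ⟨F⟩ ⟨G⟩
    have := F.2.2
    have := G.2.2
    have h : Module.finrank k (F.1.sum G.1).H1
        = Module.finrank k F.1.H1 + Module.finrank k G.1.H1 := by
      rw [(KDiagram.sumH1 F.1 G.1).finrank_eq, Module.finrank_prod]
    exact (congrArg (Nat.cast (R := ℤ)) h).trans (Nat.cast_add _ _)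

end FredholmClass

/-- Equivalence classes of virtual (Fredholm) `k`-diagrams: the Grothendieck group of the
commutative monoid of isomorphism classes of Fredholm `k`-diagrams. -/
abbrev VirtualDiagram (k : Type u) [Field k] : Type (u + 1) :=
  Algebra.GrothendieckAddGroup (FredholmClass k)

namespace VirtualDiagram

variable {k : Type u} [Field k]

/-- The class `[F ⊖ G]` of a formal difference of Fredholm `k`-diagrams. -/
noncomputable def mk (F G : KDiagram k) (hF : F.IsFredholm) (hG : G.IsFredholm) :
    VirtualDiagram k :=
  Algebra.GrothendieckAddGroup.of (FredholmClass.of F hF) -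
    Algebra.GrothendieckAddGroup.of (FredholmClass.of G hG)

/-- `[F₁ ⊖ G₁] = [F₂ ⊖ G₂]` iff `F₁ ⊕ G₂ ⊕ H ≃ F₂ ⊕ G₁ ⊕ H` for some Fredholm `H`. -/
theorem mk_eq_mk_iff {F₁ G₁ F₂ G₂ : KDiagram k} {hF₁ : F₁.IsFredholm} {hG₁ : G₁.IsFredholm}
    {hF₂ : F₂.IsFredholm} {hG₂ : G₂.IsFredholm} :
    mk F₁ G₁ hF₁ hG₁ = mk F₂ G₂ hF₂ hG₂ ↔
      ∃ H : KDiagram k, H.IsFredholm ∧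
        Nonempty (((F₁.sum G₂).sum H).Iso ((F₂.sum G₁).sum H)) := by
  have key : mk F₁ G₁ hF₁ hG₁ = mk F₂ G₂ hF₂ hG₂ ↔ ∃ c : FredholmClass k,
      FredholmClass.of F₁ hF₁ + FredholmClass.of G₂ hG₂ + c =
        FredholmClass.of F₂ hF₂ + FredholmClass.of G₁ hG₁ + c := by
    unfold mk
    rw [sub_eq_sub_iff_add_eq_add, ← map_add, ← map_add]
    refine (AddSubmonoid.LocalizationMap.eq_iff_exists
      (AddLocalization.addMonoidOf (⊤ : AddSubmonoid (FredholmClass k)))).trans ?_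
    constructor
    · rintro ⟨c, hc⟩
      exact ⟨c.1, by simpa only [add_comm] using hc⟩
    · rintro ⟨c, hc⟩
      exact ⟨⟨c, AddSubmonoid.mem_top c⟩, by simpa only [add_comm] using hc⟩
  rw [key]
  constructor
  · rintro ⟨⟨H⟩, hc⟩
    exact ⟨H.1, H.2, FredholmClass.of_eq_of_iff.1 hc⟩
  · rintro ⟨H, hH, e⟩
    exact ⟨FredholmClass.of H hH, FredholmClass.of_eq_of_iff.2 e⟩

/-- The zeroth Betti number `b⁰([F ⊖ G]) = dim H⁰(F) - dim H⁰(G)`. -/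
noncomputable def b0 (c : VirtualDiagram k) : ℤ :=
  Algebra.GrothendieckAddGroup.lift FredholmClass.betti0 c

/-- The first Betti number `b¹([F ⊖ G]) = dim H¹(F) - dim H¹(G)`. -/
noncomputable def b1 (c : VirtualDiagram k) : ℤ :=
  Algebra.GrothendieckAddGroup.lift FredholmClass.betti1 c

/-- The Euler characteristic `b⁰ - b¹`. -/
noncomputable def eulerChar (c : VirtualDiagram k) : ℤ := c.b0 - c.b1

theorem b0_mk (F G : KDiagram k) (hF : F.IsFredholm) (hG : G.IsFredholm) :
    (mk F G hF hG).b0 = Module.finrank k F.H0 - Module.finrank k G.H0 := by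
  have h : ∀ x : FredholmClass k, Algebra.GrothendieckAddGroup.lift FredholmClass.betti0
      (Algebra.GrothendieckAddGroup.of x) = FredholmClass.betti0 x := fun x =>
    DFunLike.congr_fun
      (Algebra.GrothendieckAddGroup.lift.symm_apply_apply FredholmClass.betti0) x
  unfold b0 mk
  rw [map_sub, h, h]
  rfl

theorem b1_mk (F G : KDiagram k) (hF : F.IsFredholm) (hG : G.IsFredholm) :
    (mk F G hF hG).b1 = Module.finrank k F.H1 - Module.finrank k G.H1 := by
  have h : ∀ x : FredholmClass k, Algebra.GrothendieckAddGroup.lift FredholmClass.betti1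
      (Algebra.GrothendieckAddGroup.of x) = FredholmClass.betti1 x := fun x =>
    DFunLike.congr_fun
      (Algebra.GrothendieckAddGroup.lift.symm_apply_apply FredholmClass.betti1) x
  unfold b1 mk
  rw [map_sub, h, h]
  rfl

/-- `F` and `G` are Fredholm and `c` is the class of the virtual `k`-diagram `F ⊖ G`. -/
def IsClassOf (c : VirtualDiagram k) (F G : KDiagram k) : Prop :=
  ∃ (hF : F.IsFredholm) (hG : G.IsFredholm), c = mk F G hF hG

end VirtualDiagram

/-! ### The diagrams attached to a weight -/

/-- The multiset on `ℤ²` with multiplicities `W`, as the set of all `(a, m)` with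
`1 ≤ m ≤ W(a)` (used for nonnegative `W`). -/
def MultiSupport (W : (Fin 2 → ℤ) → ℤ) : Type :=
  {x : (Fin 2 → ℤ) × ℕ // 1 ≤ x.2 ∧ (x.2 : ℤ) ≤ W x.1}

/-- The `k`-diagram `𝓜_{W,d}` of a nonnegative `W`. -/
noncomputable def matchingDiagram (k : Type u) [Field k] (W : (Fin 2 → ℤ) → ℤ)
    (d : Fin 2 → ℤ) : KDiagram k where
  B₁ := Set.Iic (d 0) →₀ k
  B₂ := Set.Iic (d 1) →₀ k
  B₃ := MultiSupport W →₀ k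
  A₁ := ℤ →₀ k
  A₂ := ℤ →₀ k
  ρ₁₁ := Finsupp.lmapDomain k k Subtype.val
  ρ₂₂ := Finsupp.lmapDomain k k Subtype.val
  ρ₃₁ := Finsupp.lmapDomain k k fun x => x.1.1 0
  ρ₃₂ := Finsupp.lmapDomain k k fun x => x.1.1 1

/-- The indicator `k`-diagram `𝓘_{d ≥ a}`: its values at `B₃, A₁, A₂` are `k`, its value at `Bⱼ`
for `j = 1, 2` is `k` if `aⱼ ≤ dⱼ` and `0` otherwise, and its maps are identities and
inclusions. -/
noncomputable def indicatorDiagram (k : Type u) [Field k] (d a : Fin 2 → ℤ) : KDiagram k where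
  B₁ := (if a 0 ≤ d 0 then ⊤ else ⊥ : Submodule k k)
  B₂ := (if a 1 ≤ d 1 then ⊤ else ⊥ : Submodule k k)
  B₃ := k
  A₁ := k
  A₂ := k
  ρ₁₁ := Submodule.subtype _
  ρ₂₂ := Submodule.subtype _
  ρ₃₁ := LinearMap.id
  ρ₃₂ := LinearMap.id

/-- The direct sum `𝓘_d^{⊕W}` of `W(a)` copies of `𝓘_{d ≥ a}` over all `a ∈ ℤ²`, for a
nonnegative `W`. -/
noncomputable def indicatorSum (k : Type u) [Field k] (W : (Fin 2 → ℤ) → ℤ) (d : Fin 2 → ℤ) :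
    KDiagram k :=
  KDiagram.directSum fun x : MultiSupport W => indicatorDiagram k d x.1.1

/-- `c` is the class `[𝓜_{W,d}]` of the weight `W` of a Riemann function `ℤ² → ℤ`: it is the class
of `(⊕ᵢ 𝓜_{Pᵢ,d}) ⊖ (⊕ᵢ 𝓜_{Qᵢ,d})` for every expression of `W` as a difference of sums
`∑ Pᵢ - ∑ Qᵢ` of perfect matchings, and it is the class of `𝓘_d^{⊕W⁺} ⊖ 𝓘_d^{⊕W⁻}`. The second
description makes sense also if `W` is unbounded and there is no such expression. -/
structure IsWeightClass {k : Type u} [Field k] (W : (Fin 2 → ℤ) → ℤ) (d : Fin 2 → ℤ)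
    (c : VirtualDiagram k) : Prop where
  of_matchings : ∀ (s : ℕ) (P : Fin (s + 1) → (Fin 2 → ℤ) → ℤ) (Q : Fin s → (Fin 2 → ℤ) → ℤ),
    IsMatchingDecomposition W P Q →
      c.IsClassOf (KDiagram.directSum fun i => matchingDiagram k (P i) d)
        (KDiagram.directSum fun i => matchingDiagram k (Q i) d)
  of_indicators : c.IsClassOf (indicatorSum k (fun a => max (W a) 0) d)
    (indicatorSum k (fun a => max (-W a) 0) d)

/-- `c` is the class `[𝓜_{f;i,j,d}]`, i.e. `[𝓜_{W,0}]` for the weight `W` of the two-variable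
restriction `f_{i,j,d}`. -/
def IsVirtualDiagramAtCoords {k : Type u} [Field k] {n : ℕ} (f : (Fin n → ℤ) → ℤ)
    (i j : Fin n) (d : Fin n → ℤ) (c : VirtualDiagram k) : Prop :=
  ∃ W, IsWeight (twoVarRestriction f i j d) W ∧ IsWeightClass W 0 c

/-- `c` is the class `[𝓜_{f at d}]`: for every choice of distinct `i, j` the class
`[𝓜_{f;i,j,d}]` exists, is uniquely determined, and equals `c`. -/
def IsVirtualDiagramAt {k : Type u} [Field k] {n : ℕ} (f : (Fin n → ℤ) → ℤ)
    (d : Fin n → ℤ) (c : VirtualDiagram k) : Prop :=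
  ∀ i j : Fin n, i ≠ j →
    ∀ x : VirtualDiagram k, IsVirtualDiagramAtCoords f i j d x ↔ x = c

/-!
By the Eilenberg swindle an acyclic `k`-diagram has class zero, and so has an infinite direct sum of
acyclic ones. The indicator diagram at `a` is acyclic unless `a ≤ d` or `a > d` in both coordinates,
and its class is constant on each of these two quadrants. Hence the class attached to `W` depends
only on the sums of `W` over the quadrants; the matching diagrams are covered as well, since the
diagram of a perfect matching is the direct sum of the indicator diagrams of its points.

The weight of `g` is its mixed second difference, so for a two-variable restriction of a Riemann
function the two sums telescope to `f(d)` and to `f(d) - deg(d) - C`, the value of the dual.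

The weight has finite rows and columns with sum `1`. If it is bounded below, adding antidiagonals
makes it a nonnegative matrix with constant line sums, which is a sum of perfect matchings by the
theorem of Birkhoff and von Neumann.
-/

namespace KDiagram

variable {k : Type u} [Field k]

/-- A `k`-diagram is acyclic if its cohomology vanishes. -/
def IsAcyclic (F : KDiagram k) : Prop := Subsingleton F.H0 ∧ Subsingleton F.H1

theorem isAcyclic_iff_bijective {F : KDiagram k} :
    F.IsAcyclic ↔ Function.Bijective F.differential := by
  rw [IsAcyclic, Submodule.subsingleton_iff_eq_bot, LinearMap.ker_eq_bot,
    Submodule.Quotient.subsingleton_iff, LinearMap.range_eq_top, Function.Bijective]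

theorem IsAcyclic.isFredholm {F : KDiagram k} (h : F.IsAcyclic) : F.IsFredholm :=
  have := h.1
  have := h.2
  ⟨inferInstance, inferInstance⟩

theorem IsFredholm.of_iso {F G : KDiagram k} (hF : F.IsFredholm) (e : F.Iso G) : G.IsFredholm :=
  have := hF.1
  have := hF.2
  ⟨Module.Finite.equiv e.eqvH0, Module.Finite.equiv e.eqvH1⟩

section DirectSum

variable {ι κ : Type}

open scoped DirectSum in
theorem IsAcyclic.directSum {F : ι → KDiagram k} (h : ∀ i, (F i).IsAcyclic) :
    (directSum F).IsAcyclic := by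
  simp only [isAcyclic_iff_bijective] at h ⊢
  let e i := LinearEquiv.ofBijective (F i).differential (h i)
  constructor
  · refine (injective_iff_map_eq_zero _).2 ?_
    rintro ⟨(x : ⨁ i, (F i).B₁), (y : ⨁ i, (F i).B₂), (z : ⨁ i, (F i).B₃)⟩ hxyz
    have h₁ : DirectSum.lmap (fun i => (F i).ρ₁₁) x - DirectSum.lmap (fun i => (F i).ρ₃₁) z = 0 :=
      congrArg Prod.fst hxyz
    have h₂ : DirectSum.lmap (fun i => (F i).ρ₂₂) y - DirectSum.lmap (fun i => (F i).ρ₃₂) z = 0 :=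
      congrArg Prod.snd hxyz
    have apply_eq_zero i : (x i, y i, z i) = (0 : (F i).B₁ × (F i).B₂ × (F i).B₃) :=
      (injective_iff_map_eq_zero _).1 (h i).1 _ <|
        Prod.ext (DFunLike.congr_fun h₁ i) (DFunLike.congr_fun h₂ i)
    exact Prod.ext (DFinsupp.ext fun i => congrArg (·.1) (apply_eq_zero i)) <|
      Prod.ext (DFinsupp.ext fun i => congrArg (·.2.1) (apply_eq_zero i))
        (DFinsupp.ext fun i => congrArg (·.2.2) (apply_eq_zero i))
  · rintro ⟨(x : ⨁ i, (F i).A₁), (y : ⨁ i, (F i).A₂)⟩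
    have apply_symm i : e i ((e i).symm (x i, y i)) = (x i, y i) := (e i).apply_symm_apply _
    have symm_zero i : (e i).symm (0, 0) = 0 := map_zero (e i).symm
    refine ⟨(DFinsupp.zipWith (fun i a c => ((e i).symm (a, c)).1) (by simp [symm_zero]) x y,
      DFinsupp.zipWith (fun i a c => ((e i).symm (a, c)).2.1) (by simp [symm_zero]) x y,
      DFinsupp.zipWith (fun i a c => ((e i).symm (a, c)).2.2) (by simp [symm_zero]) x y), ?_⟩
    exact Prod.ext (DFinsupp.ext fun i => congrArg Prod.fst (apply_symm i))
      (DFinsupp.ext fun i => congrArg Prod.snd (apply_symm i))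

/-- A direct sum of `k`-diagrams, reindexed along a bijection. -/
noncomputable def Iso.directSumReindex (e : ι ≃ κ) (F : ι → KDiagram k) :
    (directSum F).Iso (directSum fun j => F (e.symm j)) where
  b₁ := DirectSum.lequivCongrLeft k e
  b₂ := DirectSum.lequivCongrLeft k e
  b₃ := DirectSum.lequivCongrLeft k e
  a₁ := DirectSum.lequivCongrLeft k e
  a₂ := DirectSum.lequivCongrLeft k e
  comm₁₁ _ := DFinsupp.ext fun _ => rfl
  comm₂₂ _ := DFinsupp.ext fun _ => rfl
  comm₃₁ _ := DFinsupp.ext fun _ => rfl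
  comm₃₂ _ := DFinsupp.ext fun _ => rfl

/-- The summand `none` of a direct sum of `k`-diagrams, split off. -/
noncomputable def Iso.directSumOption (F : Option ι → KDiagram k) :
    (directSum F).Iso ((F none).sum (directSum fun i => F (some i))) where
  b₁ := DirectSum.lequivProdDirectSum k
  b₂ := DirectSum.lequivProdDirectSum k
  b₃ := DirectSum.lequivProdDirectSum k
  a₁ := DirectSum.lequivProdDirectSum k
  a₂ := DirectSum.lequivProdDirectSum k
  comm₁₁ _ := Prod.ext rfl (DFinsupp.ext fun _ => rfl)
  comm₂₂ _ := Prod.ext rfl (DFinsupp.ext fun _ => rfl)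
  comm₃₁ _ := Prod.ext rfl (DFinsupp.ext fun _ => rfl)
  comm₃₂ _ := Prod.ext rfl (DFinsupp.ext fun _ => rfl)

open Classical in
/-- A direct sum of `k`-diagrams over a `Sigma` type, as an iterated direct sum. -/
noncomputable def Iso.directSumSigma {σ : ι → Type} (F : (i : ι) → σ i → KDiagram k) :
    (directSum fun x : Σ i, σ i => F x.1 x.2).Iso (directSum fun i => directSum (F i)) where
  b₁ := DirectSum.sigmaLcurryEquiv k (δ := fun i j => (F i j).B₁)
  b₂ := DirectSum.sigmaLcurryEquiv k (δ := fun i j => (F i j).B₂)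
  b₃ := DirectSum.sigmaLcurryEquiv k (δ := fun i j => (F i j).B₃)
  a₁ := DirectSum.sigmaLcurryEquiv k (δ := fun i j => (F i j).A₁)
  a₂ := DirectSum.sigmaLcurryEquiv k (δ := fun i j => (F i j).A₂)
  comm₁₁ _ := DFinsupp.ext fun _ => DFinsupp.ext fun _ => rfl
  comm₂₂ _ := DFinsupp.ext fun _ => DFinsupp.ext fun _ => rfl
  comm₃₁ _ := DFinsupp.ext fun _ => DFinsupp.ext fun _ => rfl
  comm₃₂ _ := DFinsupp.ext fun _ => DFinsupp.ext fun _ => rfl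

/-- A direct sum of `k`-diagrams, grouped along the fibres of a map on the index set. -/
noncomputable def Iso.directSumFibers (p : ι → κ) (F : ι → KDiagram k) :
    (directSum F).Iso (directSum fun c => directSum fun i : {i // p i = c} => F i) :=
  (directSumReindex (Equiv.sigmaFiberEquiv p).symm F).trans
    (directSumSigma fun c (i : {i // p i = c}) => F i)

end DirectSum

/-- The isomorphism of `k`-diagrams with injective `ρ₁₁` and `ρ₂₂` that is given by its components
at `B₃`, `A₁`, `A₂`. -/
noncomputable def Iso.ofInjective {F G : KDiagram k} (hF₁ : Function.Injective F.ρ₁₁)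
    (hF₂ : Function.Injective F.ρ₂₂) (hG₁ : Function.Injective G.ρ₁₁)
    (hG₂ : Function.Injective G.ρ₂₂) (b₃ : F.B₃ ≃ₗ[k] G.B₃) (a₁ : F.A₁ ≃ₗ[k] G.A₁)
    (a₂ : F.A₂ ≃ₗ[k] G.A₂) (comm₃₁ : ∀ x, G.ρ₃₁ (b₃ x) = a₁ (F.ρ₃₁ x))
    (comm₃₂ : ∀ x, G.ρ₃₂ (b₃ x) = a₂ (F.ρ₃₂ x))
    (h₁ : (LinearMap.range F.ρ₁₁).map a₁.toLinearMap = LinearMap.range G.ρ₁₁)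
    (h₂ : (LinearMap.range F.ρ₂₂).map a₂.toLinearMap = LinearMap.range G.ρ₂₂) : F.Iso G where
  b₁ := (LinearEquiv.ofInjective _ hF₁).trans
    ((a₁.ofSubmodules _ _ h₁).trans (LinearEquiv.ofInjective _ hG₁).symm)
  b₂ := (LinearEquiv.ofInjective _ hF₂).trans
    ((a₂.ofSubmodules _ _ h₂).trans (LinearEquiv.ofInjective _ hG₂).symm)
  b₃ := b₃
  a₁ := a₁
  a₂ := a₂
  comm₁₁ _ := congrArg Subtype.val ((LinearEquiv.ofInjective _ hG₁).apply_symm_apply _)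
  comm₂₂ _ := congrArg Subtype.val ((LinearEquiv.ofInjective _ hG₂).apply_symm_apply _)
  comm₃₁ := comm₃₁
  comm₃₂ := comm₃₂

/-- `F` is Fredholm and `x` is its class in the group of virtual `k`-diagrams. -/
def HasClass (F : KDiagram k) (x : VirtualDiagram k) : Prop :=
  ∃ hF : F.IsFredholm, Algebra.GrothendieckAddGroup.of (FredholmClass.of F hF) = x

theorem IsFredholm.exists_hasClass {F : KDiagram k} (hF : F.IsFredholm) : ∃ x, F.HasClass x :=
  ⟨_, hF, rfl⟩

namespace HasClass

variable {F G : KDiagram k} {x y : VirtualDiagram k}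

theorem unique (hx : F.HasClass x) (hy : F.HasClass y) : x = y := by
  obtain ⟨_, rfl⟩ := hx
  obtain ⟨_, rfl⟩ := hy
  rfl

theorem iso (h : F.HasClass x) (e : F.Iso G) : G.HasClass x := by
  obtain ⟨hF, rfl⟩ := h
  exact ⟨hF.of_iso e, congrArg _ (FredholmClass.of_eq_of_iff.2 ⟨e.symm⟩)⟩

theorem sum (hF : F.HasClass x) (hG : G.HasClass y) : (F.sum G).HasClass (x + y) := by
  obtain ⟨hF, rfl⟩ := hF
  obtain ⟨hG, rfl⟩ := hG
  exact ⟨hF.sum hG, by rw [← FredholmClass.of_add_of, map_add]⟩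

theorem b0_eq (h : F.HasClass x) : x.b0 = Module.finrank k F.H0 := by
  obtain ⟨hF, rfl⟩ := h
  exact DFunLike.congr_fun
    (Algebra.GrothendieckAddGroup.lift.symm_apply_apply FredholmClass.betti0) _

theorem b1_eq (h : F.HasClass x) : x.b1 = Module.finrank k F.H1 := by
  obtain ⟨hF, rfl⟩ := h
  exact DFunLike.congr_fun
    (Algebra.GrothendieckAddGroup.lift.symm_apply_apply FredholmClass.betti1) _

end HasClass

/-- The Eilenberg swindle: an acyclic `F` satisfies `F ⊕ F^{⊕ℕ} ≃ F^{⊕ℕ}`, where all terms are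
Fredholm. -/
theorem IsAcyclic.hasClass_zero {F : KDiagram k} (h : F.IsAcyclic) : F.HasClass 0 := by
  have hS : (KDiagram.directSum fun _ : ℕ => F).IsAcyclic := IsAcyclic.directSum fun _ => h
  obtain ⟨x, hx⟩ := h.isFredholm.exists_hasClass
  obtain ⟨y, hy⟩ := hS.isFredholm.exists_hasClass
  have e : ℕ ≃ Option ℕ := (Denumerable.eqv (Option ℕ)).symm
  have hxy : (F.sum (KDiagram.directSum fun _ : ℕ => F)).HasClass y :=
    (hy.iso (Iso.directSumReindex e fun _ => F)).iso (Iso.directSumOption fun _ => F)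
  exact add_eq_right.1 ((hx.sum hy).unique hxy) ▸ hx

theorem HasClass.directSum {ι : Type} [Fintype ι] {F : ι → KDiagram k}
    {x : ι → VirtualDiagram k} (h : ∀ i, (F i).HasClass (x i)) :
    (directSum F).HasClass (∑ i, x i) := by
  refine Fintype.induction_empty_option (P := fun ι _ => ∀ {F : ι → KDiagram k}
    {x : ι → VirtualDiagram k}, (∀ i, (F i).HasClass (x i)) →
      (KDiagram.directSum F).HasClass (∑ i, x i)) ?of_equiv ?empty ?option ι h
  case of_equiv =>
    intro α β _ e ih F x h
    let _ : Fintype α := Fintype.ofEquiv β e.symm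
    have := (ih fun i => h (e i)).iso (Iso.directSumReindex e fun i => F (e i))
    simpa only [Equiv.apply_symm_apply, e.sum_comp] using this
  case empty =>
    intro F x _
    exact (IsAcyclic.directSum (F := F) fun i => i.elim).hasClass_zero
  case option =>
    intro α _ ih F x h
    rw [Fintype.sum_option]
    exact ((h none).sum (ih fun i => h (some i))).iso (Iso.directSumOption F).symm

theorem HasClass.directSum_of_fibers {ι κ : Type} [Fintype κ] {F : ι → KDiagram k} (p : ι → κ)
    {x : κ → VirtualDiagram k}
    (h : ∀ c, (KDiagram.directSum fun i : {i // p i = c} => F i).HasClass (x c)) :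
    (KDiagram.directSum F).HasClass (∑ c, x c) :=
  (HasClass.directSum h).iso (Iso.directSumFibers p F).symm

end KDiagram

namespace VirtualDiagram

variable {k : Type u} [Field k]

theorem isClassOf_iff {c x y : VirtualDiagram k} {F G : KDiagram k} (hF : F.HasClass x)
    (hG : G.HasClass y) : c.IsClassOf F G ↔ c = x - y := by
  obtain ⟨hF, rfl⟩ := hF
  obtain ⟨hG, rfl⟩ := hG
  exact ⟨fun ⟨_, _, h⟩ => h, fun h => ⟨hF, hG, h⟩⟩

end VirtualDiagram

section SubspaceDiagram

variable {k : Type u} [Field k] {V : Type u} [AddCommGroup V] [Module k V]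

/-- The `k`-diagram `S → V ← V → V ← T` of two subspaces of a vector space `V`, whose cohomology
measures how `S` and `T` meet and span. -/
def subspaceDiagram (S T : Submodule k V) : KDiagram k where
  B₁ := S
  B₂ := T
  B₃ := V
  A₁ := V
  A₂ := V
  ρ₁₁ := S.subtype
  ρ₂₂ := T.subtype
  ρ₃₁ := LinearMap.id
  ρ₃₂ := LinearMap.id

/-- `H⁰ ≃ S ∩ T`, the common value of the three components being `b₃`. -/
def subspaceDiagramH0Equiv (S T : Submodule k V) :
    (subspaceDiagram S T).H0 ≃ₗ[k] (S ⊓ T : Submodule k V) where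
  toFun b := ⟨b.1.2.2, by
    obtain ⟨⟨x, y, (z : V)⟩, hb⟩ := b
    have hx : x.1 - z = 0 := congrArg Prod.fst hb
    have hy : y.1 - z = 0 := congrArg Prod.snd hb
    exact ⟨sub_eq_zero.1 hx ▸ x.2, sub_eq_zero.1 hy ▸ y.2⟩⟩
  map_add' _ _ := rfl
  map_smul' _ _ := rfl
  invFun z := ⟨(⟨z, z.2.1⟩, ⟨z, z.2.2⟩, z.1), Prod.ext (sub_self z.1) (sub_self z.1)⟩
  left_inv := by
    rintro ⟨⟨x, y, (z : V)⟩, hb⟩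
    have hx : x.1 - z = 0 := congrArg Prod.fst hb
    have hy : y.1 - z = 0 := congrArg Prod.snd hb
    exact Subtype.ext (Prod.ext (Subtype.ext (sub_eq_zero.1 hx).symm)
      (Prod.ext (Subtype.ext (sub_eq_zero.1 hy).symm) rfl))
  right_inv _ := rfl

/-- `H¹ ≃ V / (S + T)`, induced by the difference map `V × V → V`. -/
noncomputable def subspaceDiagramH1Equiv (S T : Submodule k V) :
    (subspaceDiagram S T).H1 ≃ₗ[k] V ⧸ (S ⊔ T) :=
  let φ : (V × V) →ₗ[k] V ⧸ (S ⊔ T) := (S ⊔ T).mkQ ∘ₗ (LinearMap.fst k V V - LinearMap.snd k V V)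
  (Submodule.quotEquivOfEq _ (LinearMap.ker φ) (by
    ext ⟨(x : V), (y : V)⟩
    have mem_ker : (x, y) ∈ LinearMap.ker φ ↔ x - y ∈ S ⊔ T := Submodule.Quotient.mk_eq_zero _
    refine Iff.trans ?_ (mem_ker.trans Submodule.mem_sup).symm
    constructor
    · rintro ⟨⟨s, t, (z : V)⟩, hb⟩
      obtain rfl : s.1 - z = x := congrArg Prod.fst hb
      obtain rfl : t.1 - z = y := congrArg Prod.snd hb
      exact ⟨s.1, s.2, -t.1, T.neg_mem t.2, by abel⟩
    · rintro ⟨s, hs, t, ht, hst⟩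
      refine ⟨(⟨s, hs⟩, ⟨-t, T.neg_mem ht⟩, s - x), Prod.ext (sub_sub_cancel s x) ?_⟩
      change -t - (s - x) = y
      rw [← sub_sub_cancel x y, ← hst]
      abel)).trans
  (φ.quotKerEquivOfSurjective fun z => by
    obtain ⟨v, rfl⟩ := Submodule.mkQ_surjective _ z
    exact ⟨(v, 0), congrArg _ (sub_zero v)⟩)

theorem subspaceDiagram_isFredholm [Module.Finite k V] (S T : Submodule k V) :
    (subspaceDiagram S T).IsFredholm :=
  ⟨Module.Finite.equiv (subspaceDiagramH0Equiv S T).symm,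
    Module.Finite.equiv (subspaceDiagramH1Equiv S T).symm⟩

theorem isAcyclic_subspaceDiagram_of_isCompl {S T : Submodule k V} (h : IsCompl S T) :
    (subspaceDiagram S T).IsAcyclic :=
  ⟨(subspaceDiagramH0Equiv S T).toEquiv.subsingleton_congr.2
      (Submodule.subsingleton_iff_eq_bot.2 h.inf_eq_bot),
    (subspaceDiagramH1Equiv S T).toEquiv.subsingleton_congr.2
      (Submodule.Quotient.subsingleton_iff.2 h.sup_eq_top)⟩

end SubspaceDiagram

namespace VirtualDiagram

variable {k : Type u} [Field k]

section OfSubspaces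

variable {V : Type u} [AddCommGroup V] [Module k V] [Module.Finite k V]

/-- The class of the `k`-diagram of two subspaces of a finite dimensional vector space. -/
noncomputable def ofSubspaces (S T : Submodule k V) : VirtualDiagram k :=
  Algebra.GrothendieckAddGroup.of
    (FredholmClass.of (subspaceDiagram S T) (subspaceDiagram_isFredholm S T))

theorem hasClass_ofSubspaces (S T : Submodule k V) :
    (subspaceDiagram S T).HasClass (ofSubspaces S T) :=
  ⟨subspaceDiagram_isFredholm S T, rfl⟩

theorem b0_ofSubspaces (S T : Submodule k V) :
    (ofSubspaces S T).b0 = Module.finrank k (S ⊓ T : Submodule k V) := by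
  rw [(hasClass_ofSubspaces S T).b0_eq, (subspaceDiagramH0Equiv S T).finrank_eq]

theorem b1_ofSubspaces (S T : Submodule k V) :
    (ofSubspaces S T).b1 = Module.finrank k (V ⧸ (S ⊔ T)) := by
  rw [(hasClass_ofSubspaces S T).b1_eq, (subspaceDiagramH1Equiv S T).finrank_eq]

end OfSubspaces

variable (k) in
/-- The class with Betti numbers `b⁰ = m` and `b¹ = n` that is spanned by the diagrams of the pairs
`(k, k)` and `(0, 0)` of subspaces of `k`. -/
noncomputable def ofBetti (m n : ℤ) : VirtualDiagram k :=
  m • ofSubspaces (⊤ : Submodule k k) ⊤ + n • ofSubspaces (⊥ : Submodule k k) ⊥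

theorem b0_ofBetti (m n : ℤ) : (ofBetti k m n).b0 = m := by
  have h₁ := b0_ofSubspaces (⊤ : Submodule k k) ⊤
  have h₂ := b0_ofSubspaces (⊥ : Submodule k k) ⊥
  rw [inf_idem, finrank_top, Module.finrank_self] at h₁
  rw [inf_idem, finrank_bot] at h₂
  simp only [b0, ofBetti, map_add, map_zsmul] at h₁ h₂ ⊢
  simp [h₁, h₂]

theorem b1_ofBetti (m n : ℤ) : (ofBetti k m n).b1 = n := by
  have h₁ := b1_ofSubspaces (⊤ : Submodule k k) ⊤
  have h₂ := b1_ofSubspaces (⊥ : Submodule k k) ⊥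
  rw [sup_idem, Module.finrank_zero_of_subsingleton] at h₁
  rw [sup_idem, (Submodule.quotEquivOfEqBot _ rfl).finrank_eq, Module.finrank_self] at h₂
  simp only [b1, ofBetti, map_add, map_zsmul] at h₁ h₂ ⊢
  simp [h₁, h₂]

theorem ofBetti_sub_ofBetti (m n m' n' : ℤ) :
    ofBetti k m n - ofBetti k m' n' = ofBetti k (m - m') (n - n') := by
  simp only [ofBetti, sub_zsmul]
  abel

theorem sum_ofBetti {ι : Type*} (s : Finset ι) (m n : ι → ℤ) :
    ∑ i ∈ s, ofBetti k (m i) (n i) = ofBetti k (∑ i ∈ s, m i) (∑ i ∈ s, n i) := by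
  simp only [ofBetti, Finset.sum_smul, Finset.sum_add_distrib]

end VirtualDiagram

theorem KDiagram.HasClass.directSum_const {k : Type u} [Field k] {ι : Type} [Finite ι]
    {F : ι → KDiagram k} {x : VirtualDiagram k} (h : ∀ i, (F i).HasClass x) :
    (KDiagram.directSum F).HasClass (Nat.card ι • x) := by
  have := Fintype.ofFinite ι
  simpa using KDiagram.HasClass.directSum h

section MultiSupport

variable {W : (Fin 2 → ℤ) → ℤ} {A : Set (Fin 2 → ℤ)}

/-- The part of the multiset `W` over `A`, listed as a finite set of pairs. -/
noncomputable def multiSupportRestrictEquiv (hA : (A ∩ Function.support W).Finite) :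
    {x : MultiSupport W // x.1.1 ∈ A} ≃ hA.toFinset.sigma fun a => Finset.Icc 1 (W a).toNat where
  toFun x := ⟨⟨x.1.1.1, x.1.1.2⟩, by
    obtain ⟨⟨⟨a, m⟩, hm⟩, ha⟩ := x
    simp only [Finset.mem_sigma, Set.Finite.mem_toFinset, Set.mem_inter_iff,
      Function.mem_support, Finset.mem_Icc] at hm ⊢
    exact ⟨⟨ha, by omega⟩, by omega⟩⟩
  invFun y := ⟨⟨(y.1.1, y.1.2), by
    have := Finset.mem_Icc.1 (Finset.mem_sigma.1 y.2).2
    simp only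
    omega⟩, (hA.mem_toFinset.1 (Finset.mem_sigma.1 y.2).1).1⟩
  left_inv _ := rfl
  right_inv _ := rfl

theorem card_multiSupport_restrict (hW : ∀ a, 0 ≤ W a) (hA : (A ∩ Function.support W).Finite) :
    (Nat.card {x : MultiSupport W // x.1.1 ∈ A} : ℤ) = ∑ᶠ a ∈ A, W a := by
  rw [Nat.card_congr (multiSupportRestrictEquiv hA), Nat.card_eq_fintype_card, Fintype.card_coe,
    Finset.card_sigma, finsum_mem_eq_sum W hA]
  simp [hW]

theorem hasClass_directSum_multiSupport {k : Type u} [Field k] {F : (Fin 2 → ℤ) → KDiagram k}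
    {x : VirtualDiagram k} (hW : ∀ a, 0 ≤ W a) (hA : (A ∩ Function.support W).Finite)
    (hF : ∀ a ∈ A, (F a).HasClass x) :
    (KDiagram.directSum fun y : {y : MultiSupport W // y.1.1 ∈ A} => F y.1.1.1).HasClass
      ((∑ᶠ a ∈ A, W a) • x) := by
  have := Finite.of_equiv _ (multiSupportRestrictEquiv hA).symm
  rw [← card_multiSupport_restrict hW hA, natCast_zsmul]
  exact KDiagram.HasClass.directSum_const fun y => hF _ y.2

end MultiSupport

section VanishingAtInfinity

variable {n : ℕ} {W : (Fin n → ℤ) → ℤ}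

theorem apply_sub_apply_le_vecDeg_sub {d a : Fin n → ℤ} (h : a ≤ d) (i : Fin n) :
    d i - a i ≤ vecDeg d - vecDeg a := by
  rw [vecDeg, vecDeg, ← Finset.sum_sub_distrib]
  exact Finset.single_le_sum (f := fun j => d j - a j) (fun j _ => sub_nonneg.2 (h j))
    (Finset.mem_univ i)

theorem IsInitiallyZero.finite_Iic_inter_support (hW : IsInitiallyZero W) (d : Fin n → ℤ) :
    (Set.Iic d ∩ Function.support W).Finite := by
  obtain ⟨m, hm⟩ := hW
  refine (Set.finite_Icc (fun i => m - vecDeg d + d i) d).subset ?_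
  rintro a ⟨had : a ≤ d, haW⟩
  refine ⟨fun i => ?_, had⟩
  have h₁ : m < vecDeg a := not_le.1 fun h => haW (hm a h)
  have h₂ := apply_sub_apply_le_vecDeg_sub had i
  linarith

theorem IsEventuallyZero.finite_Ici_inter_support (hW : IsEventuallyZero W) (d : Fin n → ℤ) :
    (Set.Ici d ∩ Function.support W).Finite := by
  obtain ⟨m, hm⟩ := hW
  refine (Set.finite_Icc d (fun i => m - vecDeg d + d i)).subset ?_
  rintro a ⟨had : d ≤ a, haW⟩
  refine ⟨had, fun i => ?_⟩
  have h₁ : vecDeg a < m := not_le.1 fun h => haW (hm a h)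
  have h₂ := apply_sub_apply_le_vecDeg_sub had i
  linarith

theorem IsEventuallyZero.finite_strongLT_inter_support (hW : IsEventuallyZero W) (d : Fin n → ℤ) :
    ({a | StrongLT d a} ∩ Function.support W).Finite :=
  (hW.finite_Ici_inter_support d).subset <|
    Set.inter_subset_inter_left _ fun _ h => StrongLT.le h

theorem IsInitiallyZero.comp (hW : IsInitiallyZero W) {φ : ℤ → ℤ} (hφ : φ 0 = 0) :
    IsInitiallyZero fun a => φ (W a) :=
  hW.imp fun _ h a ha => (congrArg φ (h a ha)).trans hφ

theorem IsEventuallyZero.comp (hW : IsEventuallyZero W) {φ : ℤ → ℤ} (hφ : φ 0 = 0) :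
    IsEventuallyZero fun a => φ (W a) :=
  hW.imp fun _ h a ha => (congrArg φ (h a ha)).trans hφ

end VanishingAtInfinity

section IndicatorSum

variable {k : Type u} [Field k]

theorem indicatorDiagram_eq_subspaceDiagram (d a : Fin 2 → ℤ) :
    indicatorDiagram k d a =
      subspaceDiagram (if a 0 ≤ d 0 then ⊤ else ⊥ : Submodule k k)
        (if a 1 ≤ d 1 then ⊤ else ⊥) := rfl

variable {d a : Fin 2 → ℤ}

theorem hasClass_indicatorDiagram_of_le (h : a ≤ d) :
    (indicatorDiagram k d a).HasClass (.ofBetti k 1 0) := by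
  rw [indicatorDiagram_eq_subspaceDiagram, if_pos (h 0), if_pos (h 1)]
  simpa [VirtualDiagram.ofBetti] using
    VirtualDiagram.hasClass_ofSubspaces (⊤ : Submodule k k) ⊤

theorem hasClass_indicatorDiagram_of_strongLT (h : StrongLT d a) :
    (indicatorDiagram k d a).HasClass (.ofBetti k 0 1) := by
  rw [indicatorDiagram_eq_subspaceDiagram, if_neg (h 0).not_ge, if_neg (h 1).not_ge]
  simpa [VirtualDiagram.ofBetti] using
    VirtualDiagram.hasClass_ofSubspaces (⊥ : Submodule k k) ⊥

theorem isAcyclic_indicatorDiagram_of_le_of_lt (h₀ : a 0 ≤ d 0) (h₁ : d 1 < a 1) :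
    (indicatorDiagram k d a).IsAcyclic := by
  rw [indicatorDiagram_eq_subspaceDiagram, if_pos h₀, if_neg h₁.not_ge]
  exact isAcyclic_subspaceDiagram_of_isCompl isCompl_top_bot

theorem isAcyclic_indicatorDiagram_of_lt_of_le (h₀ : d 0 < a 0) (h₁ : a 1 ≤ d 1) :
    (indicatorDiagram k d a).IsAcyclic := by
  rw [indicatorDiagram_eq_subspaceDiagram, if_neg h₀.not_ge, if_pos h₁]
  exact isAcyclic_subspaceDiagram_of_isCompl isCompl_bot_top

theorem hasClass_indicatorSum {W : (Fin 2 → ℤ) → ℤ} (hW : ∀ a, 0 ≤ W a) (h₁ : IsInitiallyZero W)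
    (h₂ : IsEventuallyZero W) (d : Fin 2 → ℤ) :
    (indicatorSum k W d).HasClass
      (.ofBetti k (∑ᶠ a ∈ Set.Iic d, W a) (∑ᶠ a ∈ {a | StrongLT d a}, W a)) := by
  let quadrant (a : Fin 2 → ℤ) : Bool × Bool := (decide (a 0 ≤ d 0), decide (a 1 ≤ d 1))
  let x : Bool × Bool → VirtualDiagram k
    | (true, true) => (∑ᶠ a ∈ Set.Iic d, W a) • .ofBetti k 1 0
    | (false, false) => (∑ᶠ a ∈ {a | StrongLT d a}, W a) • .ofBetti k 0 1
    | _ => 0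
  have hx : ∑ c, x c = .ofBetti k (∑ᶠ a ∈ Set.Iic d, W a) (∑ᶠ a ∈ {a | StrongLT d a}, W a) := by
    simp [Fintype.sum_prod_type, x, VirtualDiagram.ofBetti]
  rw [← hx]
  refine KDiagram.HasClass.directSum_of_fibers (fun y => quadrant y.1.1) ?_
  rintro ⟨_ | _, _ | _⟩
  · have hd : {a | StrongLT d a} = {a | quadrant a = (false, false)} := by
      ext a
      simp [quadrant, StrongLT]
    have hfin := h₂.finite_strongLT_inter_support d
    simp only [x]
    rw [hd] at hfin ⊢
    exact hasClass_directSum_multiSupport hW hfin fun a ha =>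
      hasClass_indicatorDiagram_of_strongLT (show a ∈ {a | StrongLT d a} from hd ▸ ha)
  · refine (KDiagram.IsAcyclic.directSum fun y => ?_).hasClass_zero
    obtain ⟨h₀, h₁⟩ : d 0 < y.1.1.1 0 ∧ y.1.1.1 1 ≤ d 1 := by simpa [quadrant] using y.2
    exact isAcyclic_indicatorDiagram_of_lt_of_le h₀ h₁
  · refine (KDiagram.IsAcyclic.directSum fun y => ?_).hasClass_zero
    obtain ⟨h₀, h₁⟩ : y.1.1.1 0 ≤ d 0 ∧ d 1 < y.1.1.1 1 := by simpa [quadrant] using y.2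
    exact isAcyclic_indicatorDiagram_of_le_of_lt h₀ h₁
  · have hd : Set.Iic d = {a | quadrant a = (true, true)} := by
      ext a
      simp [quadrant, Pi.le_def]
    have hfin := h₁.finite_Iic_inter_support d
    simp only [x]
    rw [hd] at hfin ⊢
    exact hasClass_directSum_multiSupport hW hfin fun a ha =>
      hasClass_indicatorDiagram_of_le (show a ∈ Set.Iic d from hd ▸ ha)

end IndicatorSum

section MatchingDiagram

open scoped DirectSum

variable {k : Type u} [Field k] {S I : Type} [DecidableEq S] {p : S → I}

/-- The isomorphism `k^{⊕I} ≃ k^{⊕S}` given by a bijection `p : S → I`. -/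
noncomputable def finsuppEquivDirectSumOfBijective (k : Type u) [Field k]
    (hp : Function.Bijective p) : (I →₀ k) ≃ₗ[k] ⨁ _ : S, k :=
  (Finsupp.domLCongr (Equiv.ofBijective p hp).symm).trans (finsuppLEquivDirectSum k k S)

theorem finsuppEquivDirectSumOfBijective_apply (hp : Function.Bijective p) (x : I →₀ k) (i : S) :
    finsuppEquivDirectSumOfBijective k hp x i = x (p i) := by
  rw [finsuppEquivDirectSumOfBijective, LinearEquiv.trans_apply, finsuppLEquivDirectSum_apply,
    Finsupp.domLCongr_apply, Finsupp.domCongr_apply, Finsupp.equivMapDomain_apply, Equiv.symm_symm,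
    Equiv.ofBijective_apply]

theorem finsuppEquivDirectSumOfBijective_lmapDomain (hp : Function.Bijective p) (x : S →₀ k) :
    finsuppEquivDirectSumOfBijective k hp (Finsupp.lmapDomain k k p x) =
      DirectSum.lmap (fun _ => LinearMap.id (R := k) (M := k)) (finsuppLEquivDirectSum k k S x) :=
  DFinsupp.ext fun i => by
    rw [finsuppEquivDirectSumOfBijective_apply, DirectSum.lmap_apply, LinearMap.id_apply,
      finsuppLEquivDirectSum_apply, Finsupp.lmapDomain_apply, Finsupp.mapDomain_apply hp.injective]

theorem map_range_lmapDomain_subtypeVal (hp : Function.Bijective p) (A : Set I)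
    [DecidablePred (· ∈ A)] :
    (LinearMap.range (Finsupp.lmapDomain k k (Subtype.val : A → I))).map
        (finsuppEquivDirectSumOfBijective k hp).toLinearMap =
      LinearMap.range (DirectSum.lmap fun i : S =>
        (if p i ∈ A then ⊤ else ⊥ : Submodule k k).subtype) := by
  ext y
  obtain ⟨x, rfl⟩ := (finsuppEquivDirectSumOfBijective k hp).surjective y
  have mem_left : x ∈ LinearMap.range (Finsupp.lmapDomain k k (Subtype.val : A → I)) ↔
      ∀ i, p i ∉ A → x (p i) = 0 := by
    refine (Finsupp.mem_range_mapDomain_iff _ Subtype.val_injective x).trans ?_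
    rw [Subtype.range_coe, hp.surjective.forall]
  rw [Submodule.map_equiv_eq_comap_symm, Submodule.mem_comap, LinearEquiv.coe_coe,
    LinearEquiv.symm_apply_apply, mem_left, DirectSum.range_lmap, Submodule.mem_comap,
    Submodule.mem_pi]
  refine forall_congr' fun i => ?_
  rw [Submodule.range_subtype, DirectSum.coeFnLinearMap_apply,
    finsuppEquivDirectSumOfBijective_apply]
  by_cases h : p i ∈ A <;> simp [h]

end MatchingDiagram

theorem finsum_mem_sum_sub_sum {α ι κ M : Type*} [AddCommGroup M] [Fintype ι] [Fintype κ]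
    {A : Set α} {P : ι → α → M} {Q : κ → α → M} (hP : ∀ i, (A ∩ Function.support (P i)).Finite)
    (hQ : ∀ i, (A ∩ Function.support (Q i)).Finite) :
    ∑ᶠ a ∈ A, (∑ i, P i a - ∑ i, Q i a) =
      ∑ i, ∑ᶠ a ∈ A, P i a - ∑ i, ∑ᶠ a ∈ A, Q i a := by
  have hP' (i) : (A.indicator (P i)).HasFiniteSupport := by
    rw [Function.HasFiniteSupport, Set.support_indicator]
    exact hP i
  have hQ' (i) : (A.indicator (Q i)).HasFiniteSupport := by
    rw [Function.HasFiniteSupport, Set.support_indicator]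
    exact hQ i
  simp only [finsum_mem_def]
  rw [← finsum_sum_comm _ _ fun i _ => hP' i, ← finsum_sum_comm _ _ fun i _ => hQ' i,
    ← finsum_sub_distrib (.sum hP' _) (.sum hQ' _)]
  refine finsum_congr fun a => ?_
  by_cases ha : a ∈ A <;> simp [ha]

section WeightClass

variable {k : Type u} [Field k] {W : (Fin 2 → ℤ) → ℤ}

open Classical in
/-- The diagram of a matching is the direct sum of the indicator diagrams of its points. -/
noncomputable def matchingDiagramIso
    (hW : ∀ j, Function.Bijective fun x : MultiSupport W => x.1.1 j) (d : Fin 2 → ℤ) :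
    (matchingDiagram k W d).Iso (indicatorSum k W d) :=
  KDiagram.Iso.ofInjective
    (F := matchingDiagram k W d) (G := indicatorSum k W d)
    (Finsupp.mapDomain_injective Subtype.val_injective)
    (Finsupp.mapDomain_injective Subtype.val_injective)
    ((DirectSum.lmap_injective _).2 fun _ => Subtype.val_injective)
    ((DirectSum.lmap_injective _).2 fun _ => Subtype.val_injective)
    (finsuppLEquivDirectSum k k (MultiSupport W))
    (finsuppEquivDirectSumOfBijective k (hW 0)) (finsuppEquivDirectSumOfBijective k (hW 1))
    (fun x => (finsuppEquivDirectSumOfBijective_lmapDomain (hW 0) x).symm)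
    (fun x => (finsuppEquivDirectSumOfBijective_lmapDomain (hW 1) x).symm)
    (map_range_lmapDomain_subtypeVal (hW 0) (Set.Iic (d 0)))
    (map_range_lmapDomain_subtypeVal (hW 1) (Set.Iic (d 1)))

namespace IsPerfectMatching

theorem nonneg (hW : IsPerfectMatching W) (a : Fin 2 → ℤ) : 0 ≤ W a := by
  obtain ⟨-, -, π, hπ⟩ := hW
  rw [hπ]
  split_ifs <;> simp

theorem bijective_multiSupport_coord (hW : IsPerfectMatching W) (j : Fin 2) :
    Function.Bijective fun x : MultiSupport W => x.1.1 j := by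
  obtain ⟨-, -, π, hπ⟩ := hW
  have mem_graph (x : MultiSupport W) : x.1.1 1 = π (x.1.1 0) ∧ x.1.2 = 1 := by
    have h := x.2
    rw [hπ] at h
    split_ifs at h with h'
    · exact ⟨h', by omega⟩
    · omega
  have bijective_fst : Function.Bijective fun x : MultiSupport W => x.1.1 0 := by
    refine ⟨fun x y hxy => ?_, fun b => ⟨⟨(![b, π b], 1), le_rfl, by simp [hπ]⟩, rfl⟩⟩
    have hxy₁ : x.1.1 1 = y.1.1 1 := by
      rw [(mem_graph x).1, (mem_graph y).1]
      exact congrArg π hxy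
    refine Subtype.ext (Prod.ext (funext fun i => ?_) ((mem_graph x).2.trans (mem_graph y).2.symm))
    fin_cases i
    exacts [hxy, hxy₁]
  fin_cases j
  · exact bijective_fst
  · convert π.bijective.comp bijective_fst using 2 with x
    exact (mem_graph x).1

theorem hasClass (hW : IsPerfectMatching W) (d : Fin 2 → ℤ) :
    (matchingDiagram k W d).HasClass
      (.ofBetti k (∑ᶠ a ∈ Set.Iic d, W a) (∑ᶠ a ∈ {a | StrongLT d a}, W a)) :=
  (hasClass_indicatorSum hW.nonneg hW.1 hW.2.1 d).iso
    (matchingDiagramIso hW.bijective_multiSupport_coord d).symm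

end IsPerfectMatching

theorem IsMatchingDecomposition.isClassOf_iff {s : ℕ} {P : Fin (s + 1) → (Fin 2 → ℤ) → ℤ}
    {Q : Fin s → (Fin 2 → ℤ) → ℤ} (h : IsMatchingDecomposition W P Q) (d : Fin 2 → ℤ)
    (c : VirtualDiagram k) :
    c.IsClassOf (KDiagram.directSum fun i => matchingDiagram k (P i) d)
        (KDiagram.directSum fun i => matchingDiagram k (Q i) d) ↔
      c = .ofBetti k (∑ᶠ a ∈ Set.Iic d, W a) (∑ᶠ a ∈ {a | StrongLT d a}, W a) := by
  obtain ⟨hP, hQ, hW⟩ := h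
  obtain rfl : W = fun a => ∑ i, P i a - ∑ i, Q i a := funext hW
  rw [VirtualDiagram.isClassOf_iff (KDiagram.HasClass.directSum fun i => (hP i).hasClass d)
      (KDiagram.HasClass.directSum fun i => (hQ i).hasClass d),
    finsum_mem_sum_sub_sum (fun i => (hP i).1.finite_Iic_inter_support d)
      (fun i => (hQ i).1.finite_Iic_inter_support d),
    finsum_mem_sum_sub_sum (fun i => (hP i).2.1.finite_strongLT_inter_support d)
      (fun i => (hQ i).2.1.finite_strongLT_inter_support d),
    VirtualDiagram.sum_ofBetti, VirtualDiagram.sum_ofBetti, VirtualDiagram.ofBetti_sub_ofBetti]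

theorem isClassOf_indicatorSum_iff (h₁ : IsInitiallyZero W) (h₂ : IsEventuallyZero W)
    (d : Fin 2 → ℤ) (c : VirtualDiagram k) :
    c.IsClassOf (indicatorSum k (fun a => max (W a) 0) d)
        (indicatorSum k (fun a => max (-W a) 0) d) ↔
      c = .ofBetti k (∑ᶠ a ∈ Set.Iic d, W a) (∑ᶠ a ∈ {a | StrongLT d a}, W a) := by
  have hpos₁ : IsInitiallyZero fun a => max (W a) 0 := h₁.comp (φ := (max · 0)) (max_self 0)
  have hneg₁ : IsInitiallyZero fun a => max (-W a) 0 := h₁.comp (φ := fun w => max (-w) 0) (by simp)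
  have hpos₂ : IsEventuallyZero fun a => max (W a) 0 := h₂.comp (φ := (max · 0)) (max_self 0)
  have hneg₂ : IsEventuallyZero fun a => max (-W a) 0 :=
    h₂.comp (φ := fun w => max (-w) 0) (by simp)
  have finsum_eq {A : Set (Fin 2 → ℤ)} (h : (A ∩ Function.support fun a => max (W a) 0).Finite)
      (h' : (A ∩ Function.support fun a => max (-W a) 0).Finite) :
      ∑ᶠ a ∈ A, W a = ∑ᶠ a ∈ A, max (W a) 0 - ∑ᶠ a ∈ A, max (-W a) 0 := by
    have hW (a) : W a = max (W a) 0 - max (-W a) 0 := by omega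
    simpa [← hW] using finsum_mem_sum_sub_sum (ι := Unit) (κ := Unit) (fun _ => h) (fun _ => h')
  rw [VirtualDiagram.isClassOf_iff
      (hasClass_indicatorSum (fun _ => le_max_right _ _) hpos₁ hpos₂ d)
      (hasClass_indicatorSum (fun _ => le_max_right _ _) hneg₁ hneg₂ d),
    finsum_eq (hpos₁.finite_Iic_inter_support d) (hneg₁.finite_Iic_inter_support d),
    finsum_eq (hpos₂.finite_strongLT_inter_support d) (hneg₂.finite_strongLT_inter_support d),
    VirtualDiagram.ofBetti_sub_ofBetti]

theorem isWeightClass_iff (h₁ : IsInitiallyZero W) (h₂ : IsEventuallyZero W) (d : Fin 2 → ℤ)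
    (c : VirtualDiagram k) :
    IsWeightClass W d c ↔
      c = .ofBetti k (∑ᶠ a ∈ Set.Iic d, W a) (∑ᶠ a ∈ {a | StrongLT d a}, W a) :=
  ⟨fun h => (isClassOf_indicatorSum_iff h₁ h₂ d c).1 h.of_indicators, fun h =>
    ⟨fun _ _ _ hPQ => (hPQ.isClassOf_iff d c).2 h, (isClassOf_indicatorSum_iff h₁ h₂ d c).2 h⟩⟩

end WeightClass

/-- The matrix of the graph of a bijection. -/
def graphIndicator {α β : Type*} [DecidableEq β] (e : α ≃ β) (x : α) (y : β) : ℤ :=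
  if y = e x then 1 else 0

/-- Every row and every column of the integer matrix `N` has finite support and sum `r`. -/
structure HasLineSums {α β : Type*} (N : α → β → ℤ) (r : ℤ) : Prop where
  row_finite : ∀ x, (N x).HasFiniteSupport
  col_finite : ∀ y, (fun x => N x y).HasFiniteSupport
  row_sum : ∀ x, ∑ᶠ y, N x y = r
  col_sum : ∀ y, ∑ᶠ x, N x y = r

theorem graphIndicator_nonneg {α β : Type*} [DecidableEq β] (e : α ≃ β) (x : α) (y : β) :
    0 ≤ graphIndicator e x y := by
  rw [graphIndicator]
  split_ifs <;> simp

theorem hasLineSums_graphIndicator {α β : Type*} [DecidableEq β] (e : α ≃ β) :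
    HasLineSums (graphIndicator e) 1 where
  row_finite x := (Set.finite_singleton (e x)).subset fun y hy => by
    by_contra h
    exact hy (if_neg h)
  col_finite y := (Set.finite_singleton (e.symm y)).subset fun x hx => by
    by_contra h
    exact hx (if_neg fun h' => h (e.eq_symm_apply.2 h'.symm))
  row_sum x := (finsum_eq_single _ (e x) fun _ hy => if_neg hy).trans (if_pos rfl)
  col_sum y := by
    refine (finsum_eq_single _ (e.symm y) fun x hx => if_neg fun h => hx ?_).trans (if_pos ?_)
    · exact e.eq_symm_apply.2 h.symm
    · exact (e.apply_symm_apply y).symm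

namespace HasLineSums

variable {α β : Type*} {N N' : α → β → ℤ} {r r' : ℤ}

theorem transpose (h : HasLineSums N r) : HasLineSums (fun y x => N x y) r :=
  ⟨h.col_finite, h.row_finite, h.col_sum, h.row_sum⟩

theorem add (h : HasLineSums N r) (h' : HasLineSums N' r') :
    HasLineSums (fun x y => N x y + N' x y) (r + r') where
  row_finite x := (h.row_finite x).add (h'.row_finite x)
  col_finite y := (h.col_finite y).add (h'.col_finite y)
  row_sum x := by rw [finsum_add_distrib (h.row_finite x) (h'.row_finite x), h.row_sum, h'.row_sum]
  col_sum y := by rw [finsum_add_distrib (h.col_finite y) (h'.col_finite y), h.col_sum, h'.col_sum]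

theorem sub (h : HasLineSums N r) (h' : HasLineSums N' r') :
    HasLineSums (fun x y => N x y - N' x y) (r - r') where
  row_finite x := (h.row_finite x).sub (h'.row_finite x)
  col_finite y := (h.col_finite y).sub (h'.col_finite y)
  row_sum x := by rw [finsum_sub_distrib (h.row_finite x) (h'.row_finite x), h.row_sum, h'.row_sum]
  col_sum y := by rw [finsum_sub_distrib (h.col_finite y) (h'.col_finite y), h.col_sum, h'.col_sum]

theorem sum {ι : Type*} {N : ι → α → β → ℤ} {r : ι → ℤ} (h : ∀ i, HasLineSums (N i) (r i))
    (s : Finset ι) : HasLineSums (fun x y => ∑ i ∈ s, N i x y) (∑ i ∈ s, r i) where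
  row_finite x := .sum (fun i => (h i).row_finite x) s
  col_finite y := .sum (fun i => (h i).col_finite y) s
  row_sum x := by
    rw [finsum_sum_comm _ _ fun i _ => (h i).row_finite x]
    simp only [(h _).row_sum]
  col_sum y := by
    rw [finsum_sum_comm _ _ fun i _ => (h i).col_finite y]
    simp only [(h _).col_sum]

theorem exists_injective (h : HasLineSums N r) (hN : ∀ x y, 0 ≤ N x y) (hr : 0 < r) :
    ∃ f : α → β, Function.Injective f ∧ ∀ x, N x (f x) ≠ 0 := by
  classical
  let R x := (h.row_finite x).toFinset
  suffices hall : ∀ s : Finset α, s.card ≤ (s.biUnion R).card by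
    obtain ⟨f, hf, hfR⟩ := (Finset.all_card_le_biUnion_card_iff_exists_injective R).1 hall
    exact ⟨f, hf, fun x => (h.row_finite x).mem_toFinset.1 (hfR x)⟩
  intro s
  have support_subset : ∀ x ∈ s, Function.support (N x) ⊆ s.biUnion R := fun x hx y hy =>
    Finset.mem_biUnion.2 ⟨x, hx, (h.row_finite x).mem_toFinset.2 hy⟩
  have double_count : (s.card : ℤ) * r ≤ (s.biUnion R).card * r := calc
    (s.card : ℤ) * r = ∑ x ∈ s, ∑ᶠ y, N x y := by simp [h.row_sum]
    _ = ∑ x ∈ s, ∑ y ∈ s.biUnion R, N x y := Finset.sum_congr rfl fun x hx =>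
      finsum_eq_sum_of_support_subset _ (support_subset x hx)
    _ = ∑ y ∈ s.biUnion R, ∑ x ∈ s, N x y := Finset.sum_comm
    _ ≤ ∑ y ∈ s.biUnion R, ∑ᶠ x, N x y := Finset.sum_le_sum fun y _ => by
      have hsub : (Function.support fun x => N x y) ⊆ ↑(s ∪ (h.col_finite y).toFinset) :=
        fun x hx => Finset.mem_union_right _ ((h.col_finite y).mem_toFinset.2 hx)
      rw [finsum_eq_sum_of_support_subset _ hsub]
      exact Finset.sum_le_sum_of_subset_of_nonneg Finset.subset_union_left fun x _ _ => hN x y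
    _ = (s.biUnion R).card * r := by simp [h.col_sum]
  exact_mod_cast le_of_mul_le_mul_right double_count hr

/-- König's theorem. Constant line sums give Hall's condition for rows and for columns, and the two
injections combine by Schröder–Bernstein. -/
theorem exists_equiv (h : HasLineSums N r) (hN : ∀ x y, 0 ≤ N x y) (hr : 0 < r) :
    ∃ e : α ≃ β, ∀ x, N x (e x) ≠ 0 := by
  obtain ⟨f, hf, hNf⟩ := h.exists_injective hN hr
  obtain ⟨g, hg, hNg⟩ := h.transpose.exists_injective (fun y x => hN x y) hr
  obtain ⟨e, he, hNe⟩ := Function.Embedding.schroeder_bernstein_of_rel hf hg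
    (fun x y => N x y ≠ 0) hNf hNg
  exact ⟨Equiv.ofBijective e he, hNe⟩

theorem exists_eq_sum_graphIndicator [DecidableEq β] {r : ℕ} (h : HasLineSums N r)
    (hN : ∀ x y, 0 ≤ N x y) :
    ∃ e : Fin r → α ≃ β, ∀ x y, N x y = ∑ i, graphIndicator (e i) x y := by
  induction r generalizing N with
  | zero =>
    refine ⟨Fin.elim0, fun x y => le_antisymm ?_ (hN x y)⟩
    calc N x y ≤ ∑ᶠ y, N x y := single_le_finsum y (h.row_finite x) (hN x)
      _ = ∑ i : Fin 0, _ := by simp [h.row_sum]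
  | succ r ih =>
    obtain ⟨e, he⟩ := h.exists_equiv hN (by positivity)
    have graph_le (x y) : graphIndicator e x y ≤ N x y := by
      rw [graphIndicator]
      split_ifs with hy
      · exact hy ▸ (hN x _).lt_of_ne' (he x)
      · exact hN x y
    have hsub : HasLineSums (fun x y => N x y - graphIndicator e x y) r := by
      simpa using h.sub (hasLineSums_graphIndicator e)
    obtain ⟨σ, hσ⟩ := ih hsub fun x y => sub_nonneg.2 (graph_le x y)
    refine ⟨Fin.cons e σ, fun x y => ?_⟩
    rw [Fin.sum_univ_succ, Fin.cons_zero, ← sub_eq_iff_eq_add']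
    exact hσ x y

end HasLineSums

theorem vecDeg_fin_two (a : Fin 2 → ℤ) : vecDeg a = a 0 + a 1 :=
  Fin.sum_univ_two a

theorem vec_fin_two_eta (a : Fin 2 → ℤ) : ![a 0, a 1] = a := by
  ext i
  fin_cases i <;> rfl

section VanishingAtInfinity

variable {n : ℕ} {f g : (Fin n → ℤ) → ℤ}

theorem IsInitiallyZero.add (hf : IsInitiallyZero f) (hg : IsInitiallyZero g) :
    IsInitiallyZero fun d => f d + g d := by
  obtain ⟨⟨m, hm⟩, m', hm'⟩ := And.intro hf hg
  exact ⟨min m m', fun d hd => by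
    simp [hm d (hd.trans (min_le_left _ _)), hm' d (hd.trans (min_le_right _ _))]⟩

theorem IsEventuallyZero.add (hf : IsEventuallyZero f) (hg : IsEventuallyZero g) :
    IsEventuallyZero fun d => f d + g d := by
  obtain ⟨⟨M, hM⟩, M', hM'⟩ := And.intro hf hg
  exact ⟨max M M', fun d hd => by
    simp [hM d ((le_max_left _ _).trans hd), hM' d ((le_max_right _ _).trans hd)]⟩

theorem IsInitiallyZero.sum {ι : Type*} {f : ι → (Fin n → ℤ) → ℤ} (hf : ∀ i, IsInitiallyZero (f i))
    (s : Finset ι) : IsInitiallyZero fun d => ∑ i ∈ s, f i d := by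
  induction s using Finset.cons_induction with
  | empty => exact ⟨0, fun _ _ => rfl⟩
  | cons i s hi ih => simpa only [Finset.sum_cons] using (hf i).add ih

theorem IsEventuallyZero.sum {ι : Type*} {f : ι → (Fin n → ℤ) → ℤ}
    (hf : ∀ i, IsEventuallyZero (f i)) (s : Finset ι) :
    IsEventuallyZero fun d => ∑ i ∈ s, f i d := by
  induction s using Finset.cons_induction with
  | empty => exact ⟨0, fun _ _ => rfl⟩
  | cons i s hi ih => simpa only [Finset.sum_cons] using (hf i).add ih

end VanishingAtInfinity

section MatchingDecomposition

variable {W : (Fin 2 → ℤ) → ℤ}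

theorem IsPerfectMatching.hasLineSums (hW : IsPerfectMatching W) :
    HasLineSums (fun x y => W ![x, y]) 1 := by
  obtain ⟨-, -, π, hπ⟩ := hW
  convert hasLineSums_graphIndicator π with x y
  exact hπ _

theorem isPerfectMatching_antidiagonal (c : ℤ) :
    IsPerfectMatching fun a => graphIndicator (Equiv.subLeft c) (a 0) (a 1) := by
  have eq_zero (a : Fin 2 → ℤ) (ha : vecDeg a ≠ c) :
      graphIndicator (Equiv.subLeft c) (a 0) (a 1) = 0 := by
    refine if_neg fun h => ha ?_
    rw [vecDeg_fin_two, h, Equiv.subLeft_apply, add_sub_cancel]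
  exact ⟨⟨c - 1, fun a ha => eq_zero a (by omega)⟩, ⟨c + 1, fun a ha => eq_zero a (by omega)⟩,
    Equiv.subLeft c, fun _ => rfl⟩

theorem exists_isPerfectMatching_nonneg_add_sum {B : ℤ} (h₁ : IsInitiallyZero W)
    (h₂ : IsEventuallyZero W) (hB : ∀ a, -B ≤ W a) :
    ∃ (s : ℕ) (Q : Fin s → (Fin 2 → ℤ) → ℤ),
      (∀ i, IsPerfectMatching (Q i)) ∧ ∀ a, 0 ≤ W a + ∑ i, Q i a := by
  obtain ⟨⟨m, hm⟩, M, hM⟩ := And.intro h₁ h₂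
  let antidiagonal (c : ℤ) (a : Fin 2 → ℤ) : ℤ := graphIndicator (Equiv.subLeft c) (a 0) (a 1)
  let D := Finset.Ioo m M ×ˢ Finset.range B.toNat
  refine ⟨D.card, fun i => antidiagonal (D.equivFin.symm i).1.1,
    fun i => isPerfectMatching_antidiagonal _, fun a => ?_⟩
  have antidiagonal_nonneg (c : ℤ) : 0 ≤ antidiagonal c a := graphIndicator_nonneg _ _ _
  have sum_eq : ∑ i, antidiagonal (D.equivFin.symm i).1.1 a =
      B.toNat * ∑ c ∈ Finset.Ioo m M, antidiagonal c a := by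
    rw [Equiv.sum_comp D.equivFin.symm fun p => antidiagonal p.1.1 a,
      Finset.sum_coe_sort D fun p => antidiagonal p.1 a, Finset.sum_product]
    simp [Finset.mul_sum]
  have sum_nonneg : 0 ≤ ∑ c ∈ Finset.Ioo m M, antidiagonal c a :=
    Finset.sum_nonneg fun c _ => antidiagonal_nonneg c
  rw [sum_eq]
  by_cases hWa : W a = 0
  · rw [hWa]
    positivity
  · have ha : vecDeg a ∈ Finset.Ioo m M :=
      Finset.mem_Ioo.2 ⟨not_le.1 fun h => hWa (hm a h), not_le.1 fun h => hWa (hM a h)⟩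
    have one_le : 1 ≤ ∑ c ∈ Finset.Ioo m M, antidiagonal c a := calc
      1 = antidiagonal (vecDeg a) a := by
        simp [antidiagonal, graphIndicator, vecDeg_fin_two]
      _ ≤ _ := Finset.single_le_sum (fun c _ => antidiagonal_nonneg c) ha
    have := hB a
    have := Int.self_le_toNat B
    nlinarith

theorem exists_isMatchingDecomposition {B : ℤ} (h₁ : IsInitiallyZero W) (h₂ : IsEventuallyZero W)
    (hW : HasLineSums (fun x y => W ![x, y]) 1) (hB : ∀ a, -B ≤ W a) :
    ∃ (s : ℕ) (P : Fin (s + 1) → (Fin 2 → ℤ) → ℤ) (Q : Fin s → (Fin 2 → ℤ) → ℤ),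
      IsMatchingDecomposition W P Q := by
  obtain ⟨s, Q, hQ, nonneg⟩ := exists_isPerfectMatching_nonneg_add_sum h₁ h₂ hB
  have hlines : HasLineSums (fun x y => W ![x, y] + ∑ i, Q i ![x, y]) ↑(s + 1) := by
    simpa [add_comm] using hW.add (.sum (fun i => (hQ i).hasLineSums) Finset.univ)
  obtain ⟨e, he⟩ := hlines.exists_eq_sum_graphIndicator fun x y => nonneg _
  have total_eq (a : Fin 2 → ℤ) :
      W a + ∑ i, Q i a = ∑ i, graphIndicator (e i) (a 0) (a 1) := by
    rw [← he, vec_fin_two_eta]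
  have eq_zero {a : Fin 2 → ℤ} (ha : W a + ∑ i, Q i a = 0) (i : Fin (s + 1)) :
      graphIndicator (e i) (a 0) (a 1) = 0 := by
    rw [total_eq, Finset.sum_eq_zero_iff_of_nonneg fun i _ => graphIndicator_nonneg _ _ _] at ha
    exact ha i (Finset.mem_univ i)
  refine ⟨s, fun i a => graphIndicator (e i) (a 0) (a 1), Q, fun i => ⟨?_, ?_, e i, fun _ => rfl⟩,
    hQ, fun a => eq_sub_of_add_eq (total_eq a)⟩
  · exact (h₁.add (.sum (fun i => (hQ i).1) Finset.univ)).imp fun m hm a ha => eq_zero (hm a ha) i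
  · exact (h₂.add (.sum (fun i => (hQ i).2.1) Finset.univ)).imp fun M hM a ha => eq_zero (hM a ha) i

theorem IsPerfectMatching.le_one (hW : IsPerfectMatching W) (a : Fin 2 → ℤ) : W a ≤ 1 := by
  obtain ⟨-, -, π, hπ⟩ := hW
  rw [hπ]
  split_ifs <;> simp

theorem IsMatchingDecomposition.abs_le {s : ℕ} {P : Fin (s + 1) → (Fin 2 → ℤ) → ℤ}
    {Q : Fin s → (Fin 2 → ℤ) → ℤ} (h : IsMatchingDecomposition W P Q) (a : Fin 2 → ℤ) :
    |W a| ≤ s + 1 := by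
  obtain ⟨hP, hQ, hW⟩ := h
  have hP₀ : 0 ≤ ∑ i, P i a := Finset.sum_nonneg fun i _ => (hP i).nonneg a
  have hQ₀ : 0 ≤ ∑ i, Q i a := Finset.sum_nonneg fun i _ => (hQ i).nonneg a
  have hP₁ : ∑ i, P i a ≤ s + 1 := by
    simpa using Finset.sum_le_card_nsmul Finset.univ _ 1 fun i _ => (hP i).le_one a
  have hQ₁ : ∑ i, Q i a ≤ s := by
    simpa using Finset.sum_le_card_nsmul Finset.univ _ 1 fun i _ => (hQ i).le_one a
  rw [hW, _root_.abs_le]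
  omega

end MatchingDecomposition

section Telescoping

variable {G : Type*} [AddCommGroup G] {u : ℤ → G} {p q : ℤ}

theorem sum_Ioc_eq_sum_Ioc_sub_one_add (u : ℤ → G) (h : p < q) :
    ∑ x ∈ Finset.Ioc p q, u x = ∑ x ∈ Finset.Ioc p (q - 1), u x + u q := by
  rw [← Finset.insert_Ioc_sub_one_right_eq_Ioc h, Finset.sum_insert (by simp), add_comm]

theorem sum_Ioc_sub_sub_one (u : ℤ → G) (h : p ≤ q) :
    ∑ x ∈ Finset.Ioc p q, (u x - u (x - 1)) = u q - u p := by
  induction q, h using Int.leInduction with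
  | base => simp
  | succ q h ih =>
    rw [sum_Ioc_eq_sum_Ioc_sub_one_add _ (by omega), add_sub_cancel_right, ih,
      add_comm, sub_add_sub_cancel]

theorem support_sub_sub_one_subset {c : G} (hp : ∀ x ≤ p, u x = 0) (hq : ∀ x ≥ q, u x = c) :
    (Function.support fun x => u x - u (x - 1)) ⊆ Finset.Ioc p q := by
  intro x hx
  by_contra h
  rw [Finset.mem_coe, Finset.mem_Ioc, not_and_or, not_lt, not_le] at h
  refine hx (sub_eq_zero.2 ?_)
  rcases h with h | h
  · rw [hp x h, hp (x - 1) (by omega)]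
  · rw [hq x (by omega), hq (x - 1) (by omega)]

theorem finsum_sub_sub_one {c : G} (hp : ∀ x ≤ p, u x = 0) (hq : ∀ x ≥ q, u x = c) :
    ∑ᶠ x, (u x - u (x - 1)) = c := by
  rw [finsum_eq_sum_of_support_subset _ ((support_sub_sub_one_subset hp hq).trans
      (Finset.coe_subset.2 (Finset.Ioc_subset_Ioc_right (le_max_right p q)))),
    sum_Ioc_sub_sub_one u (le_max_left p q), hp p le_rfl, hq _ (le_max_right p q), sub_zero]

end Telescoping

section Weights

variable {g W : (Fin 2 → ℤ) → ℤ} {m M C : ℤ}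

/-- The mixed second difference of a function on `ℤ²`, i.e. its Möbius inversion with respect to
the componentwise order. -/
def mixedDiff (g : (Fin 2 → ℤ) → ℤ) (a : Fin 2 → ℤ) : ℤ :=
  g ![a 0, a 1] - g ![a 0 - 1, a 1] - (g ![a 0, a 1 - 1] - g ![a 0 - 1, a 1 - 1])

theorem vecDeg_cons_cons (x y : ℤ) : vecDeg ![x, y] = x + y :=
  vecDeg_fin_two _

theorem sum_sum_mixedDiff (g : (Fin 2 → ℤ) → ℤ) {p p' q q' : ℤ} (hp : p ≤ p') (hq : q ≤ q') :
    ∑ x ∈ Finset.Ioc p p', ∑ y ∈ Finset.Ioc q q', mixedDiff g ![x, y] =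
      g ![p', q'] - g ![p', q] - (g ![p, q'] - g ![p, q]) := by
  rw [← sum_Ioc_sub_sub_one (fun x => g ![x, q'] - g ![x, q]) hp]
  refine Finset.sum_congr rfl fun x _ => ?_
  calc ∑ y ∈ Finset.Ioc q q', mixedDiff g ![x, y]
    _ = g ![x, q'] - g ![x - 1, q'] - (g ![x, q] - g ![x - 1, q]) :=
      sum_Ioc_sub_sub_one (fun y => g ![x, y] - g ![x - 1, y]) hq
    _ = _ := sub_sub_sub_comm _ _ _ _

theorem finsum_mem_eq_sum_sum {A : Set (Fin 2 → ℤ)} {I J : Finset ℤ}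
    (hA : ∀ a ∈ A, W a ≠ 0 → a 0 ∈ I ∧ a 1 ∈ J) (hIJ : ∀ x ∈ I, ∀ y ∈ J, ![x, y] ∈ A) :
    ∑ᶠ a ∈ A, W a = ∑ x ∈ I, ∑ y ∈ J, W ![x, y] := by
  classical
  have image_subset : ↑((I ×ˢ J).image fun z => ![z.1, z.2]) ⊆ A := fun a ha => by
    obtain ⟨z, hz, rfl⟩ := Finset.mem_image.1 ha
    exact hIJ _ (Finset.mem_product.1 hz).1 _ (Finset.mem_product.1 hz).2
  have subset_image : A ∩ Function.support W ⊆ ↑((I ×ˢ J).image fun z => ![z.1, z.2]) :=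
    fun a ha => Finset.mem_image.2
      ⟨(a 0, a 1), Finset.mem_product.2 (hA a ha.1 ha.2), vec_fin_two_eta a⟩
  rw [finsum_mem_eq_sum_of_subset W subset_image image_subset, Finset.sum_image fun z _ w _ h =>
    Prod.ext (congrFun h 0) (congrFun h 1), Finset.sum_product]

theorem finsum_mem_Iic_eq_sum_sum (hm : ∀ a, vecDeg a ≤ m → W a = 0) {p q x y : ℤ}
    (hp : p + y ≤ m) (hq : x + q ≤ m) :
    ∑ᶠ a ∈ Set.Iic ![x, y], W a = ∑ z ∈ Finset.Ioc p x, ∑ w ∈ Finset.Ioc q y, W ![z, w] := by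
  refine finsum_mem_eq_sum_sum (fun a ha haW => ?_) fun z hz w hw => ?_
  · have ha₀ : a 0 ≤ x := ha 0
    have ha₁ : a 1 ≤ y := ha 1
    have hlt := not_le.1 (mt (hm a) haW)
    rw [vecDeg_fin_two] at hlt
    simp only [Finset.mem_Ioc]
    omega
  · rw [Set.mem_Iic, Pi.le_def, Fin.forall_fin_two]
    exact ⟨(Finset.mem_Ioc.1 hz).2, (Finset.mem_Ioc.1 hw).2⟩

theorem mixedDiff_eq_zero_of_vecDeg_le (hm : ∀ a, vecDeg a ≤ m → g a = 0) {a : Fin 2 → ℤ}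
    (ha : vecDeg a ≤ m) : mixedDiff g a = 0 := by
  rw [vecDeg_fin_two] at ha
  rw [mixedDiff, hm, hm, hm, hm, sub_self] <;> rw [vecDeg_cons_cons] <;> omega

theorem mixedDiff_eq_zero_of_le_vecDeg (hM : ∀ a, M ≤ vecDeg a → g a = vecDeg a + C)
    {a : Fin 2 → ℤ} (ha : M + 2 ≤ vecDeg a) : mixedDiff g a = 0 := by
  rw [vecDeg_fin_two] at ha
  rw [mixedDiff, hM, hM, hM, hM] <;> simp only [vecDeg_cons_cons] <;> omega

theorem IsInitiallyZero.isWeight_mixedDiff (hg : IsInitiallyZero g) : IsWeight g (mixedDiff g) := by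
  obtain ⟨m, hm⟩ := hg
  refine ⟨⟨m, fun a => mixedDiff_eq_zero_of_vecDeg_le hm⟩, fun d => ?_⟩
  obtain ⟨x, y, rfl⟩ : ∃ x y, d = ![x, y] := ⟨_, _, (vec_fin_two_eta d).symm⟩
  let p := min x (m - y)
  let q := min y (m - x)
  calc g ![x, y]
    _ = g ![x, y] - g ![x, q] - (g ![p, y] - g ![p, q]) := by
      rw [hm ![x, q], hm ![p, y], hm ![p, q]]
      · ring
      all_goals
        rw [vecDeg_cons_cons]
        omega
    _ = ∑ z ∈ Finset.Ioc p x, ∑ w ∈ Finset.Ioc q y, mixedDiff g ![z, w] :=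
      (sum_sum_mixedDiff g (by omega) (by omega)).symm
    _ = ∑ᶠ a ∈ Set.Iic ![x, y], mixedDiff g a :=
      (finsum_mem_Iic_eq_sum_sum (fun a => mixedDiff_eq_zero_of_vecDeg_le hm)
        (by omega) (by omega)).symm

theorem IsWeight.eq_mixedDiff (h : IsWeight g W) : W = mixedDiff g := by
  obtain ⟨⟨m, hm⟩, hW⟩ := h
  funext a
  let p := min (a 0 - 1) (m - a 1)
  let q := min (a 1 - 1) (m - a 0)
  have eq_sum_sum (x y : ℤ) (hx : x ≤ a 0) (hy : y ≤ a 1) :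
      g ![x, y] = ∑ z ∈ Finset.Ioc p x, ∑ w ∈ Finset.Ioc q y, W ![z, w] :=
    (hW _).trans (finsum_mem_Iic_eq_sum_sum hm (by omega) (by omega))
  have column_sum (y : ℤ) (hy : y ≤ a 1) :
      g ![a 0, y] - g ![a 0 - 1, y] = ∑ w ∈ Finset.Ioc q y, W ![a 0, w] := by
    rw [eq_sum_sum _ _ le_rfl hy, eq_sum_sum _ _ (by omega) hy,
      sum_Ioc_eq_sum_Ioc_sub_one_add _ (by omega), add_sub_cancel_left]
  rw [mixedDiff, column_sum _ le_rfl, column_sum _ (by omega),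
    sum_Ioc_eq_sum_Ioc_sub_one_add _ (by omega), add_sub_cancel_left, vec_fin_two_eta]

theorem IsRiemannFunction.isEventuallyZero_mixedDiff (hg : IsRiemannFunction g C) :
    IsEventuallyZero (mixedDiff g) := by
  obtain ⟨-, M, hM⟩ := hg
  exact ⟨M + 2, fun a => mixedDiff_eq_zero_of_le_vecDeg hM⟩

/-- On a large box above `d`, the values of `g` at the corners other than `d` are given by the
Riemann-Roch formula. -/
theorem IsRiemannFunction.finsum_strongLT_mixedDiff (hg : IsRiemannFunction g C) (d : Fin 2 → ℤ) :
    ∑ᶠ a ∈ {a | StrongLT d a}, mixedDiff g a = g d - (vecDeg d + C) := by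
  obtain ⟨-, M, hM⟩ := hg
  obtain ⟨x, y, rfl⟩ : ∃ x y, d = ![x, y] := ⟨_, _, (vec_fin_two_eta d).symm⟩
  let p := max x (M + 2 - y)
  let q := max y (M + 2 - x)
  have mem_box (a : Fin 2 → ℤ) (ha : StrongLT ![x, y] a) (haW : mixedDiff g a ≠ 0) :
      a 0 ∈ Finset.Ioc x p ∧ a 1 ∈ Finset.Ioc y q := by
    have ha₀ : x < a 0 := ha 0
    have ha₁ : y < a 1 := ha 1
    have hlt := not_le.1 (mt (mixedDiff_eq_zero_of_le_vecDeg hM) haW)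
    rw [vecDeg_fin_two] at hlt
    simp only [Finset.mem_Ioc]
    omega
  have strongLT (z) (hz : z ∈ Finset.Ioc x p) (w) (hw : w ∈ Finset.Ioc y q) :
      StrongLT ![x, y] ![z, w] :=
    Fin.forall_fin_two.2 ⟨(Finset.mem_Ioc.1 hz).1, (Finset.mem_Ioc.1 hw).1⟩
  rw [finsum_mem_eq_sum_sum (A := {a | StrongLT ![x, y] a}) mem_box strongLT,
    sum_sum_mixedDiff g (by omega) (by omega), hM ![p, q], hM ![p, y], hM ![x, q]] <;>
    simp only [vecDeg_cons_cons]
  · ring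
  all_goals omega

theorem IsRiemannFunction.hasLineSums_mixedDiff (hg : IsRiemannFunction g C) :
    HasLineSums (fun x y => mixedDiff g ![x, y]) 1 := by
  obtain ⟨⟨m, hm⟩, M, hM⟩ := hg
  have row_eq (x y : ℤ) : mixedDiff g ![x, y] =
      g ![x, y] - g ![x - 1, y] - (g ![x, y - 1] - g ![x - 1, y - 1]) := rfl
  have col_eq (x y : ℤ) : mixedDiff g ![x, y] =
      g ![x, y] - g ![x, y - 1] - (g ![x - 1, y] - g ![x - 1, y - 1]) := by
    rw [row_eq, sub_sub_sub_comm]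
  have row_zero (x y : ℤ) (h : y ≤ m - x) : g ![x, y] - g ![x - 1, y] = 0 := by
    rw [hm, hm, sub_self] <;> rw [vecDeg_cons_cons] <;> omega
  have row_one (x y : ℤ) (h : y ≥ M + 1 - x) : g ![x, y] - g ![x - 1, y] = 1 := by
    rw [hM, hM] <;> simp only [vecDeg_cons_cons] <;> omega
  have col_zero (y x : ℤ) (h : x ≤ m - y) : g ![x, y] - g ![x, y - 1] = 0 := by
    rw [hm, hm, sub_self] <;> rw [vecDeg_cons_cons] <;> omega
  have col_one (y x : ℤ) (h : x ≥ M + 1 - y) : g ![x, y] - g ![x, y - 1] = 1 := by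
    rw [hM, hM] <;> simp only [vecDeg_cons_cons] <;> omega
  refine ⟨fun x => ?_, fun y => ?_, fun x => ?_, fun y => ?_⟩
  · exact (Finset.finite_toSet _).subset (support_sub_sub_one_subset (row_zero x) (row_one x))
  · simp only [col_eq]
    exact (Finset.finite_toSet _).subset (support_sub_sub_one_subset (col_zero y) (col_one y))
  · exact finsum_sub_sub_one (row_zero x) (row_one x)
  · simp only [col_eq]
    exact finsum_sub_sub_one (col_zero y) (col_one y)

theorem IsRiemannFunction.exists_isMatchingDecomposition_iff (hg : IsRiemannFunction g C) :
    (∃ (s : ℕ) (P : Fin (s + 1) → (Fin 2 → ℤ) → ℤ) (Q : Fin s → (Fin 2 → ℤ) → ℤ),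
      IsMatchingDecomposition (mixedDiff g) P Q) ↔ ∃ B : ℤ, ∀ a, |mixedDiff g a| ≤ B :=
  ⟨fun ⟨_, _, _, h⟩ => ⟨_, h.abs_le⟩, fun ⟨_, hB⟩ =>
    exists_isMatchingDecomposition hg.1.isWeight_mixedDiff.1 hg.isEventuallyZero_mixedDiff
      hg.hasLineSums_mixedDiff fun a => neg_le_of_abs_le (hB a)⟩

end Weights

section RiemannFunctions

variable {n : ℕ} {f : (Fin n → ℤ) → ℤ} {C : ℤ}

theorem vecDeg_sub (d e : Fin n → ℤ) : vecDeg (d - e) = vecDeg d - vecDeg e :=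
  Finset.sum_sub_distrib _ _

theorem vecDeg_add_single_add_single (i j : Fin n) (d : Fin n → ℤ) (a : Fin 2 → ℤ) :
    vecDeg (d + Pi.single i (a 0) + Pi.single j (a 1)) = vecDeg d + vecDeg a := by
  simp only [vecDeg, Pi.add_apply, Finset.sum_add_distrib, Finset.sum_pi_single',
    Finset.mem_univ, if_true, Fin.sum_univ_two, add_assoc]

theorem twoVarRestriction_zero (f : (Fin n → ℤ) → ℤ) (i j : Fin n) (d : Fin n → ℤ) :
    twoVarRestriction f i j d 0 = f d := by
  simp only [twoVarRestriction, Pi.zero_apply, Pi.single_zero, add_zero]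

theorem riemannDual_sub (f : (Fin n → ℤ) → ℤ) (C : ℤ) (K d : Fin n → ℤ) :
    riemannDual f C K (K - d) = f d - (vecDeg d + C) := by
  rw [riemannDual, sub_sub_cancel, sub_sub]

namespace IsRiemannFunction

protected theorem twoVarRestriction (hf : IsRiemannFunction f C) (i j : Fin n) (d : Fin n → ℤ) :
    IsRiemannFunction (twoVarRestriction f i j d) (vecDeg d + C) := by
  obtain ⟨⟨m, hm⟩, M, hM⟩ := hf
  refine ⟨⟨m - vecDeg d, fun a ha => hm _ ?_⟩, M - vecDeg d, fun a ha => (hM _ ?_).trans ?_⟩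
  all_goals
    rw [vecDeg_add_single_add_single]
    omega

protected theorem riemannDual (hf : IsRiemannFunction f C) (K : Fin n → ℤ) :
    IsRiemannFunction (riemannDual f C K) (-vecDeg K - C) := by
  obtain ⟨⟨m, hm⟩, M, hM⟩ := hf
  refine ⟨⟨vecDeg K - M, fun a ha => ?_⟩, vecDeg K - m, fun a ha => ?_⟩
  · rw [riemannDual, hM _ (by rw [vecDeg_sub]; omega)]
    ring
  · rw [riemannDual, hm _ (by rw [vecDeg_sub]; omega), vecDeg_sub]
    ring

theorem isVirtualDiagramAt {k : Type u} [Field k] (hf : IsRiemannFunction f C) (d : Fin n → ℤ) :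
    IsVirtualDiagramAt f d (.ofBetti k (f d) (f d - (vecDeg d + C))) := by
  intro i j _ c
  have hg := hf.twoVarRestriction i j d
  have hW := hg.1.isWeight_mixedDiff
  have finsum_Iic : ∑ᶠ a ∈ Set.Iic 0, mixedDiff (twoVarRestriction f i j d) a = f d :=
    (hW.2 0).symm.trans (twoVarRestriction_zero f i j d)
  have finsum_strongLT : ∑ᶠ a ∈ {a | StrongLT 0 a}, mixedDiff (twoVarRestriction f i j d) a =
      f d - (vecDeg d + C) := by
    rw [hg.finsum_strongLT_mixedDiff, twoVarRestriction_zero, vecDeg_fin_two, Pi.zero_apply,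
      Pi.zero_apply, add_zero, zero_add]
  rw [← finsum_strongLT, ← finsum_Iic,
    ← isWeightClass_iff hW.1 hg.isEventuallyZero_mixedDiff 0 c]
  exact ⟨fun ⟨_, hW', hc⟩ => hW'.eq_mixedDiff ▸ hc, fun hc => ⟨_, hW, hc⟩⟩

end IsRiemannFunction

end RiemannFunctions

theorem mainTheorem6 (k : Type u) [Field k] (n : ℕ) (hn : 2 ≤ n) (f : (Fin n → ℤ) → ℤ) (C : ℤ)
    (hf : IsRiemannFunction f C) :
    (∀ (d : Fin n → ℤ) (i j : Fin n), i ≠ j →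
      ∃! W : (Fin 2 → ℤ) → ℤ, IsWeight (twoVarRestriction f i j d) W) ∧
    (∀ (d : Fin n → ℤ) (i j : Fin n), i ≠ j →
      ∀ W : (Fin 2 → ℤ) → ℤ, IsWeight (twoVarRestriction f i j d) W →
        ((∃ (s : ℕ) (P : Fin (s + 1) → (Fin 2 → ℤ) → ℤ) (Q : Fin s → (Fin 2 → ℤ) → ℤ),
            IsMatchingDecomposition W P Q) ↔ ∃ B : ℤ, ∀ a, |W a| ≤ B)) ∧
    ∀ d K : Fin n → ℤ,
      IsRiemannFunction (riemannDual f C K) (-vecDeg K - C) ∧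
      ∃ c c' : VirtualDiagram k,
        IsVirtualDiagramAt f d c ∧
        IsVirtualDiagramAt (riemannDual f C K) (K - d) c' ∧
        c.b0 = f d ∧
        c.eulerChar = vecDeg d + C ∧
        c.b1 = riemannDual f C K (K - d) ∧
        riemannDual f C K (K - d) = c'.b0 := by
  refine ⟨fun d i j _ => ?_, fun d i j _ W hW => ?_, fun d K => ⟨hf.riemannDual K, ?_⟩⟩
  · exact ⟨_, (hf.twoVarRestriction i j d).1.isWeight_mixedDiff, fun W hW => hW.eq_mixedDiff⟩
  · rw [hW.eq_mixedDiff]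
    exact (hf.twoVarRestriction i j d).exists_isMatchingDecomposition_iff
  · refine ⟨_, _, hf.isVirtualDiagramAt d, (hf.riemannDual K).isVirtualDiagramAt (K - d),
      VirtualDiagram.b0_ofBetti _ _, ?_, ?_, (VirtualDiagram.b0_ofBetti _ _).symm⟩
    · rw [VirtualDiagram.eulerChar, VirtualDiagram.b0_ofBetti, VirtualDiagram.b1_ofBetti,
        sub_sub_cancel]
    · rw [VirtualDiagram.b1_ofBetti, riemannDual_sub]
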